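/- Let $\mathbb X$ be a Polish space with its Borel $\sigma$-field, let $\mathcal P_{\mathbb X}$ be the space of probability measures on $\mathbb X$ with the $\sigma$-field generated by the topology of weak convergence (equivalently, by the evaluations $p\mapsto p(A)$, $A$ Borel), let $\alpha$ be a nonzero finite measure on $\mathbb X$ with total mass $a=\alpha(\mathbb X)>0$, and fix an integer $n\ge 1$. A Dirichlet process with parameter $\alpha$ is a random element $P$ of $\mathcal P_{\mathbb X}$ such that, for every finite measurable partition $B_1,\dots,B_k$ of $\mathbb X$, the vector $(P(B_1),\dots,P(B_k))$ has the Dirichlet distribution with parameter $(\alpha(B_1),\dots,\alpha(B_k))$ (components with parameter $0$ being a.s. $0$). A Pólya sequence with parameter $\alpha$ is a sequence $(Y_j)_{j\ge1}$ of $\mathbb X$-valued random variables with $\mathbb P(Y_1\in A)=\alpha(A)/a$ and, for every $j\ge 1$ and Borel set $A$, $$\mathbb P(Y_{j+1}\in A\mid Y_1,\dots,Y_j)=\frac{\alpha(A)+\sum_{i=1}^{j}\delta_{Y_i}(A)}{a+j}\quad\text{a.s.}$$ On a probability space let $\theta$ have the Beta distribution with parameters $(n,a)$, let $q^{(n)}=(q^{(n)}_1,\dots,q^{(n)}_n)$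 have the Dirichlet distribution with parameter $(1,\dots,1)$, let $(Y_j)_{j\ge1}$ be a Pólya sequence with parameter $\alpha$, and let $P$ be a random element of $\mathcal P_{\mathbb X}$, where $P$, $\theta$, $q^{(n)}$ and $(Y_1,\dots,Y_n)$ are mutually independent. **Theorem.** The Dirichlet process with parameter $\alpha$ is the unique solution (in law) of the distributional equation $$P\stackrel{\mathrm d}{=}\theta\sum_{i=1}^{n}q^{(n)}_i\,\delta_{Y_i}+(1-\theta)P .$$ That is: there is exactly one law on $\mathcal P_{\mathbb X}$ of a Dirichlet process with parameter $\alpha$; whenever $P,\theta,q^{(n)},(Y_j)$ are as above, on any probability space, $P$ satisfies the equation if and only if $P$ is a Dirichlet process with parameter $\alpha$; and there are a probability space and such $P,\theta,q^{(n)},(Y_j)$ on it with $P$ a Dirichlet process with parameter $\alpha$. -/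

import Mathlib

open MeasureTheory ProbabilityTheory
open scoped ENNReal

universe u v

/-- The Gamma distribution with shape `c` and rate `1`, which is the point mass at `0` when the
shape is `0` (the usual degenerate case; only shapes `c ≥ 0` matter). -/
noncomputable def gammaLaw (c : ℝ) : Measure ℝ :=
  if 0 < c then gammaMeasure c 1 else Measure.dirac 0

instance isProbabilityMeasure_gammaLaw (c : ℝ) : IsProbabilityMeasure (gammaLaw c) := by
  unfold gammaLaw
  split_ifs with h
  · exact isProbabilityMeasure_gammaMeasure h one_pos
  · infer_instance

/-- The Dirichlet distribution with parameters `c i ≥ 0`, not all zero: the law of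
`(Z i / ∑ j, Z j) i`, where the `Z i` are independent and `Z i` has the Gamma distribution with
shape `c i` and rate `1`. A component whose parameter is zero vanishes almost surely. -/
noncomputable def dirichletMeasure {ι : Type*} [Fintype ι] (c : ι → ℝ) : Measure (ι → ℝ) :=
  (Measure.pi fun i => gammaLaw (c i)).map fun z i => z i / ∑ j, z j

/-- `D` is the law of a Dirichlet process on `X` with parameter `α`: a probability measure on the
space of probability measures on `X` under which, for each finite measurable partition
`B 0, …, B (k - 1)` of `X`, the vector `(p (B 0), …, p (B (k - 1)))` has the Dirichlet distribution
with parameter `(α (B 0), …, α (B (k - 1)))`. -/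
structure IsDirichletProcessLaw {X : Type*} [MeasurableSpace X] (α : Measure X)
    (D : Measure (ProbabilityMeasure X)) : Prop where
  isProbabilityMeasure : IsProbabilityMeasure D
  hasLaw_partition : ∀ (k : ℕ) (B : Fin k → Set X), (∀ i, MeasurableSet (B i)) →
    Pairwise (fun i j => Disjoint (B i) (B j)) → (⋃ i, B i) = Set.univ →
    HasLaw (fun (p : ProbabilityMeasure X) (i : Fin k) => (p : Measure X).real (B i))
      (dirichletMeasure fun i => α.real (B i)) D

/-- `Y 0, Y 1, …` is a Pólya sequence with parameter `α`: the first term has law `α / α(X)`, and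
given the first `j ≥ 1` terms the conditional probability that the next one lies in `A` is
`(α(A) + ∑_{i < j} δ_{Y i}(A)) / (α(X) + j)`. -/
structure IsPolyaSequence {X Ω : Type*} [MeasurableSpace X] [MeasurableSpace Ω]
    (α : Measure X) (μ : Measure Ω) (Y : ℕ → Ω → X) : Prop where
  measurable : ∀ j, Measurable (Y j)
  hasLaw_zero : HasLaw (Y 0) ((α Set.univ)⁻¹ • α) μ
  predictive : ∀ j : ℕ, 1 ≤ j → ∀ A : Set X, MeasurableSet A →
    μ⟦Y j ⁻¹' A | MeasurableSpace.comap (fun ω (i : Fin j) => Y i ω) inferInstance⟧ =ᵐ[μ]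
      fun ω => (α.real A + ∑ i : Fin j, (Measure.dirac (Y i ω)).real A) / (α.real Set.univ + j)

/-- The random elements in the distributional equation, on the probability space `(Ω, μ)`:
`θ ∼ Beta(n, α(X))`, `q ∼ Dirichlet(1, …, 1)`, a Pólya sequence `Y` with parameter `α` and a random
probability measure `P`, such that `P`, `θ`, `q` and `(Y 0, …, Y (n - 1))` are mutually
independent. -/
structure IsEquationData {X Ω : Type*} [MeasurableSpace X] [MeasurableSpace Ω]
    (α : Measure X) (n : ℕ) (μ : Measure Ω) (θ : Ω → ℝ) (q : Ω → Fin n → ℝ)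
    (Y : ℕ → Ω → X) (P : Ω → ProbabilityMeasure X) : Prop where
  measurable_theta : Measurable θ
  hasLaw_theta : HasLaw θ (betaMeasure n (α.real Set.univ)) μ
  measurable_q : Measurable q
  hasLaw_q : HasLaw q (dirichletMeasure fun _ => 1) μ
  polya : IsPolyaSequence α μ Y
  measurable_P : Measurable P
  indep : iIndep ![MeasurableSpace.comap P inferInstance, MeasurableSpace.comap θ inferInstance,
    MeasurableSpace.comap q inferInstance,
    MeasurableSpace.comap (fun ω (i : Fin n) => Y i ω) inferInstance] μ

/-- The measure `t ∑ i, w i δ_{y i} + (1 - t) p`. It is a probability measure whenever `0 ≤ t ≤ 1`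
and `w` is a probability vector. -/
noncomputable def mixture {X : Type*} [MeasurableSpace X] {n : ℕ} (t : ℝ) (w : Fin n → ℝ)
    (y : Fin n → X) (p : ProbabilityMeasure X) : Measure X :=
  ENNReal.ofReal t • ∑ i, ENNReal.ofReal (w i) • Measure.dirac (y i)
    + ENNReal.ofReal (1 - t) • (p : Measure X)

/-- `P` satisfies the equation `P =_d θ ∑ i, q i δ_{Y i} + (1 - θ) P`. The right-hand side is almost
surely a probability measure; both sides are compared as random elements of the space of measures
on `X` with the σ-algebra generated by the evaluations `m ↦ m A`. -/
def SolvesEquation {X Ω : Type*} [MeasurableSpace X] [MeasurableSpace Ω]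
    {n : ℕ} (μ : Measure Ω) (θ : Ω → ℝ) (q : Ω → Fin n → ℝ)
    (Y : ℕ → Ω → X) (P : Ω → ProbabilityMeasure X) : Prop :=
  IdentDistrib (fun ω => (P ω : Measure X))
    (fun ω => mixture (θ ω) (q ω) (fun i => Y i ω) (P ω)) μ μ

/-! The law of a random probability measure is determined by the joint laws of its masses on finite
measurable partitions (`map_eq_of_partition`). On a partition with cell parameters `c`, the equation
becomes `V =_d θ W + (1 - θ) V` for a random probability vector `V`, where `W = ∑ i, q i e_{cell (Y
i)}`.

Uniqueness is a contraction argument (`eq_of_eq_mixtureLaw`). If two solutions have characteristic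
functions differing by at most `C ‖L‖` at every linear functional `L`, then applying the equation
once improves the bound to `C E(1 - θ) ‖L‖`, and `E(1 - θ) < 1`.

That `Dirichlet(c)` is a solution rests on Gamma variables. A vector of independent Gamma variables
is its total times an independent Dirichlet vector; everything else follows by computing with
unnormalized Gamma vectors. Given `Y`, let `N` be the vector of cell counts of `Y 0, …, Y (n - 1)`.
Regrouping `Dirichlet(1, …, 1)` by cells gives `W ∼ Dirichlet(N)`, and since `θ ∼ Beta(n, a)` with
`n = ∑ N` and `a = ∑ c`, Beta-Gamma algebra gives `θ W + (1 - θ) V ∼ Dirichlet(c + N)`. Averaging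
over `Y` returns `Dirichlet(c)`: the predictive probability of a cell is its current parameter
divided by the total, and `Dirichlet(c)` is the mixture of the `Dirichlet(c + e_j)` with weights `c
j / ∑ c`, by size-biasing the Gamma variables.

Existence comes from stick-breaking: iterating the equation produces a random series that satisfies
it pathwise and has mass `1` almost surely. Its cell masses then solve the same equation as the
Dirichlet law, so uniqueness identifies them. Pólya sequences come from the Ionescu-Tulcea
construction. -/

/-! ### Gamma and Beta densities, Beta-Gamma algebra. -/

theorem measurable_gammaPDF (a r : ℝ) : Measurable (gammaPDF a r) :=
  (measurable_gammaPDFReal a r).ennreal_ofReal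

theorem measurable_betaPDF (a b : ℝ) : Measurable (betaPDF a b) :=
  (measurable_betaPDFReal a b).ennreal_ofReal

attribute [fun_prop] measurable_gammaPDF measurable_betaPDF

theorem lintegral_mul_left_eq {s : ℝ} (hs : 0 < s) {f : ℝ → ℝ≥0∞} (hf : Measurable f) :
    ∫⁻ x, f x = ENNReal.ofReal s * ∫⁻ t, f (s * t) := by
  have h := Real.map_volume_mul_left hs.ne'
  have h2 : ∫⁻ t, f (s * t) = ENNReal.ofReal |s⁻¹| * ∫⁻ x, f x := by
    rw [← lintegral_map hf (by fun_prop : Measurable fun t => s * t), h, lintegral_smul_measure,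
      smul_eq_mul]
  rw [h2, ← mul_assoc, ← ENNReal.ofReal_mul hs.le, abs_of_pos (inv_pos.2 hs),
    mul_inv_cancel₀ hs.ne', ENNReal.ofReal_one, one_mul]

/-- The density form of Beta-Gamma algebra; the factor `s` is the Jacobian of `(s, t) ↦ (s t, s (1 -
t))`. The endpoints `t = 0, 1` are excluded because `betaPDF` vanishes there while a Gamma density
of shape `1` does not vanish at `0`. -/
theorem gammaPDF_mul_gammaPDF {a b s t : ℝ} (ha : 0 < a) (hb : 0 < b) (hs : 0 < s)
    (ht0 : t ≠ 0) (ht1 : t ≠ 1) :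
    ENNReal.ofReal s * (gammaPDF a 1 (s * t) * gammaPDF b 1 (s - s * t)) =
      gammaPDF (a + b) 1 s * betaPDF a b t := by
  rcases lt_or_gt_of_ne ht0 with h | h
  · rw [gammaPDF_of_neg (mul_neg_of_pos_of_neg hs h), betaPDF_eq_zero_of_nonpos h.le]; simp
  rcases lt_or_gt_of_ne ht1 with h1 | h1
  swap
  · rw [gammaPDF_of_neg (a := b) (by nlinarith), betaPDF_eq_zero_of_one_le h1.le]; simp
  have h1' : 0 < 1 - t := by linarith
  have e : s - s * t = s * (1 - t) := by ring
  rw [e, gammaPDF_of_nonneg (by positivity), gammaPDF_of_nonneg (by positivity),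
    gammaPDF_of_nonneg hs.le, betaPDF_of_pos_lt_one h h1]
  have hGa := Real.Gamma_pos_of_pos ha
  have hGb := Real.Gamma_pos_of_pos hb
  have hGab := Real.Gamma_pos_of_pos (add_pos ha hb)
  rw [← ENNReal.ofReal_mul (by positivity), ← ENNReal.ofReal_mul (by positivity),
    ← ENNReal.ofReal_mul (by positivity)]
  congr 1
  rw [Real.mul_rpow hs.le h.le, Real.mul_rpow hs.le h1'.le, beta]
  have e1 : s ^ (a + b - 1) = s * s ^ (a - 1) * s ^ (b - 1) := by
    rw [show a + b - 1 = 1 + (a - 1) + (b - 1) by ring, Real.rpow_add hs, Real.rpow_add hs,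
      Real.rpow_one]
  have e2 : Real.exp (-(1 * s)) = Real.exp (-(1 * (s * t))) * Real.exp (-(1 * (s * (1 - t)))) := by
    rw [← Real.exp_add]; ring_nf
  rw [e1, e2]
  simp only [Real.one_rpow]
  field_simp

theorem lintegral_gammaMeasure (a r : ℝ) {f : ℝ → ℝ≥0∞} (hf : Measurable f) :
    ∫⁻ x, f x ∂gammaMeasure a r = ∫⁻ x, gammaPDF a r x * f x := by
  rw [gammaMeasure, lintegral_withDensity_eq_lintegral_mul _ (measurable_gammaPDF a r) hf]; rfl

theorem lintegral_betaMeasure (a b : ℝ) {f : ℝ → ℝ≥0∞} (hf : Measurable f) :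
    ∫⁻ x, f x ∂betaMeasure a b = ∫⁻ x, betaPDF a b x * f x := by
  rw [betaMeasure, lintegral_withDensity_eq_lintegral_mul _ (measurable_betaPDF a b) hf]; rfl

theorem sFinite_gammaMeasure (a r : ℝ) : SFinite (gammaMeasure a r) := by
  unfold gammaMeasure; infer_instance

theorem sFinite_betaMeasure (a b : ℝ) : SFinite (betaMeasure a b) := by
  unfold betaMeasure; infer_instance

attribute [instance] sFinite_gammaMeasure sFinite_betaMeasure

/-- The change of variables `(x, y) = (s t, s (1 - t))` is split into one-dimensional ones: the
shift `y = s - x` for fixed `x`, an exchange of integrals, and the scaling `x = s t` for fixed `s >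
0`. -/
theorem lintegral_lintegral_gammaMeasure {a b : ℝ} (ha : 0 < a) (hb : 0 < b)
    {F : ℝ → ℝ → ℝ≥0∞} (hF : Measurable (Function.uncurry F)) :
    ∫⁻ x, ∫⁻ y, F x y ∂gammaMeasure b 1 ∂gammaMeasure a 1 =
      ∫⁻ s, ∫⁻ t, F (s * t) (s * (1 - t)) ∂betaMeasure a b ∂gammaMeasure (a + b) 1 := by
  have hF' : ∀ x, Measurable (F x) := fun x => hF.of_uncurry_left
  have hFc : ∀ {γ : Type} [MeasurableSpace γ] {f g : γ → ℝ}, Measurable f → Measurable g →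
      Measurable fun z => F (f z) (g z) := fun hf hg => hF.comp (hf.prodMk hg)
  rw [lintegral_gammaMeasure _ _ (Measurable.lintegral_prod_right' (f := fun p : ℝ × ℝ => F p.1 p.2)
      (hFc measurable_fst measurable_snd)),
    lintegral_gammaMeasure _ _ (Measurable.lintegral_prod_right'
      (f := fun p : ℝ × ℝ => F (p.1 * p.2) (p.1 * (1 - p.2))) (hFc (by fun_prop) (by fun_prop)))]
  have hL : ∀ x, gammaPDF a 1 x * ∫⁻ y, F x y ∂gammaMeasure b 1 =
      ∫⁻ s, gammaPDF a 1 x * (gammaPDF b 1 (s - x) * F x (s - x)) := by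
    intro x
    rw [lintegral_gammaMeasure _ _ (hF' x), ← lintegral_const_mul _ (by fun_prop),
      ← lintegral_sub_right_eq_self _ x]
  have hg : Measurable fun p : ℝ × ℝ =>
      gammaPDF a 1 p.1 * (gammaPDF b 1 (p.2 - p.1) * F p.1 (p.2 - p.1)) := by
    have := hFc (γ := ℝ × ℝ) measurable_fst (measurable_snd.sub measurable_fst)
    fun_prop
  simp_rw [hL]
  rw [lintegral_lintegral_swap hg.aemeasurable]
  have h0 : ∀ᵐ s : ℝ, s ≠ 0 := by simp [ae_iff]
  have h1 : ∀ᵐ s : ℝ, s ≠ 1 := by simp [ae_iff]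
  refine lintegral_congr_ae ?_
  filter_upwards [h0] with s hs
  rcases lt_or_gt_of_ne hs with hs | hs
  -- For `s < 0` one of `x` and `s - x` is negative, so the product of densities vanishes.
  · rw [gammaPDF_of_neg hs, zero_mul]
    refine (lintegral_congr fun x => ?_).trans lintegral_zero
    rcases lt_or_ge x 0 with hx | hx
    · simp [gammaPDF_of_neg hx]
    · simp [gammaPDF_of_neg (show s - x < 0 by linarith)]
  have hgs : Measurable fun x => gammaPDF a 1 x * (gammaPDF b 1 (s - x) * F x (s - x)) :=
    hg.comp (measurable_id.prodMk measurable_const)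
  rw [lintegral_mul_left_eq hs hgs,
    lintegral_betaMeasure _ _ (hFc (by fun_prop) (by fun_prop)),
    ← lintegral_const_mul' _ _ ENNReal.ofReal_ne_top,
    ← lintegral_const_mul' (gammaPDF (a + b) 1 s) _ ENNReal.ofReal_ne_top]
  refine lintegral_congr_ae ?_
  filter_upwards [h0, h1] with t ht0 ht1
  have := gammaPDF_mul_gammaPDF ha hb hs ht0 ht1
  rw [← mul_assoc _ (betaPDF a b t), ← this, show s * (1 - t) = s - s * t by ring]
  ring

theorem gammaLaw_of_pos {c : ℝ} (hc : 0 < c) : gammaLaw c = gammaMeasure c 1 := if_pos hc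

theorem gammaLaw_zero : gammaLaw 0 = Measure.dirac 0 := if_neg (lt_irrefl 0)

theorem ae_gammaLaw_pos {c : ℝ} (hc : 0 < c) : ∀ᵐ x ∂gammaLaw c, 0 < x := by
  rw [gammaLaw_of_pos hc, gammaMeasure, ae_withDensity_iff (measurable_gammaPDF _ _)]
  have h0 : ∀ᵐ s : ℝ, s ≠ 0 := by simp [ae_iff]
  filter_upwards [h0] with x hx h
  by_contra h'
  exact h (gammaPDF_of_neg (lt_of_le_of_ne (not_lt.1 h') hx))

theorem ae_gammaLaw_nonneg {c : ℝ} (hc : 0 ≤ c) : ∀ᵐ x ∂gammaLaw c, 0 ≤ x := by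
  rcases hc.eq_or_lt with rfl | hc
  · rw [gammaLaw_zero]; simp
  · filter_upwards [ae_gammaLaw_pos hc] with x hx using hx.le

theorem ae_betaMeasure (a b : ℝ) : ∀ᵐ x ∂betaMeasure a b, 0 < x ∧ x < 1 := by
  rw [betaMeasure, ae_withDensity_iff (measurable_betaPDF _ _)]
  refine ae_of_all _ fun x h => ⟨?_, ?_⟩ <;> by_contra h'
  · exact h (betaPDF_eq_zero_of_nonpos (not_lt.1 h'))
  · exact h (betaPDF_eq_zero_of_one_le (not_lt.1 h'))

/-- Beta-Gamma algebra. -/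
theorem lintegral_lintegral_gammaLaw {a b : ℝ} (ha : 0 < a) (hb : 0 < b)
    {F : ℝ → ℝ → ℝ≥0∞} (hF : Measurable (Function.uncurry F)) :
    ∫⁻ x, ∫⁻ y, F x y ∂gammaLaw b ∂gammaLaw a =
      ∫⁻ s, ∫⁻ t, F (s * t) (s * (1 - t)) ∂betaMeasure a b ∂gammaLaw (a + b) := by
  rw [gammaLaw_of_pos ha, gammaLaw_of_pos hb, gammaLaw_of_pos (add_pos ha hb),
    lintegral_lintegral_gammaMeasure ha hb hF]

/-- In the Beta-Gamma variables the sum is `s t + s (1 - t) = s`. Zero shapes are point masses at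
`0` and are treated apart, since the Beta law needs positive parameters. -/
theorem lintegral_lintegral_gammaLaw_add {a b : ℝ} (ha : 0 ≤ a) (hb : 0 ≤ b)
    {f : ℝ → ℝ≥0∞} (hf : Measurable f) :
    ∫⁻ x, ∫⁻ y, f (x + y) ∂gammaLaw b ∂gammaLaw a = ∫⁻ s, f s ∂gammaLaw (a + b) := by
  rcases ha.eq_or_lt with rfl | ha
  · rw [gammaLaw_zero, lintegral_dirac' _ (Measurable.lintegral_prod_right'
      (f := fun p : ℝ × ℝ => f (p.1 + p.2)) (by fun_prop))]
    simp
  rcases hb.eq_or_lt with rfl | hb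
  · rw [gammaLaw_zero]
    simp only [add_zero]
    refine lintegral_congr fun x => ?_
    rw [lintegral_dirac' _ (by fun_prop), add_zero]
  have := isProbabilityMeasureBeta ha hb
  rw [lintegral_lintegral_gammaLaw (F := fun x y => f (x + y)) ha hb
    (by unfold Function.uncurry; fun_prop)]
  refine lintegral_congr fun s => ?_
  simp [← mul_add]

/-! ### Vectors of independent Gamma variables. -/

theorem lintegral_pi_insertNth {k : ℕ} (μ : Fin (k + 1) → Measure ℝ) [∀ i, SigmaFinite (μ i)]
    (j : Fin (k + 1)) {F : (Fin (k + 1) → ℝ) → ℝ≥0∞} (hF : Measurable F) :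
    ∫⁻ z, F z ∂Measure.pi μ =
      ∫⁻ x, ∫⁻ z, F (j.insertNth x z) ∂Measure.pi (fun i => μ (j.succAbove i)) ∂μ j := by
  have h := (measurePreserving_piFinSuccAbove μ j).symm
  rw [← h.lintegral_comp (f := F) hF,
    lintegral_prod (fun a => F ((MeasurableEquiv.piFinSuccAbove (fun _ => ℝ) j).symm a))
      (hF.comp h.measurable).aemeasurable]
  rfl

theorem lintegral_pi_fin_succ {k : ℕ} (μ : Fin (k + 1) → Measure ℝ) [∀ i, SigmaFinite (μ i)]
    {F : (Fin (k + 1) → ℝ) → ℝ≥0∞} (hF : Measurable F) :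
    ∫⁻ z, F z ∂Measure.pi μ =
      ∫⁻ x, ∫⁻ z, F (Fin.cons x z) ∂Measure.pi (fun i => μ i.succ) ∂μ 0 := by
  rw [lintegral_pi_insertNth μ 0 hF]
  simp

theorem lintegral_pi_gammaLaw_add {ι : Type*} [Fintype ι] {b c : ι → ℝ} (hb : ∀ i, 0 ≤ b i)
    (hc : ∀ i, 0 ≤ c i) {F : (ι → ℝ) → ℝ≥0∞} (hF : Measurable F) :
    ∫⁻ y, ∫⁻ z, F (y + z) ∂Measure.pi (fun i => gammaLaw (c i))
        ∂Measure.pi (fun i => gammaLaw (b i)) =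
      ∫⁻ z, F z ∂Measure.pi (fun i => gammaLaw (b i + c i)) := by
  have h1 : ∀ i, ((gammaLaw (b i)).prod (gammaLaw (c i))).map (fun p => p.1 + p.2) =
      gammaLaw (b i + c i) := by
    intro i
    refine Measure.ext_of_lintegral _ fun f hf => ?_
    rw [lintegral_map hf (by fun_prop), lintegral_prod _ (by fun_prop)]
    exact lintegral_lintegral_gammaLaw_add (hb i) (hc i) hf
  have h2 := measurePreserving_arrowProdEquivProdArrow ℝ ℝ ι (fun i => gammaLaw (b i))
    (fun i => gammaLaw (c i))
  have h3 : Measure.pi (fun i => gammaLaw (b i + c i)) =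
      (Measure.pi fun i => (gammaLaw (b i)).prod (gammaLaw (c i))).map
        (fun z i => (z i).1 + (z i).2) := by
    simp_rw [← h1]
    have : ∀ i, SigmaFinite (((gammaLaw (b i)).prod (gammaLaw (c i))).map
        (fun p => p.1 + p.2)) := fun i => by rw [h1]; infer_instance
    exact (Measure.pi_map_pi (f := fun _ (p : ℝ × ℝ) => p.1 + p.2)
      (fun i => by fun_prop)).symm
  rw [h3, lintegral_map hF (by fun_prop)]
  have h4 : Measurable fun p : (ι → ℝ) × (ι → ℝ) => F (p.1 + p.2) :=
    hF.comp (measurable_fst.add measurable_snd)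
  rw [← lintegral_prod (fun p : (ι → ℝ) × (ι → ℝ) => F (p.1 + p.2)) h4.aemeasurable,
    ← h2.lintegral_comp h4]
  rfl

theorem pi_gammaLaw_zero (ι : Type*) [Fintype ι] :
    Measure.pi (fun _ : ι => gammaLaw 0) = Measure.dirac 0 := by
  rw [gammaLaw_zero]
  refine Measure.pi_eq fun s hs => ?_
  rw [Measure.dirac_apply' _ (MeasurableSet.univ_pi hs)]
  simp_rw [Measure.dirac_apply' _ (hs _)]
  by_cases h : ∀ i, (0 : ℝ) ∈ s i
  · simp [h]
  · push Not at h
    obtain ⟨i, hi⟩ := h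
    rw [Finset.prod_eq_zero (Finset.mem_univ i) (by simp [hi]), Set.indicator_of_notMem]
    intro h'
    exact hi (h' i (Set.mem_univ i))

@[fun_prop]
theorem measurable_fin_cons {k : ℕ} {Ω : Type*} [MeasurableSpace Ω] {f : Ω → ℝ}
    {g : Ω → Fin k → ℝ} (hf : Measurable f) (hg : Measurable g) :
    Measurable fun ω => (Fin.cons (f ω) (g ω) : Fin (k + 1) → ℝ) := by
  refine measurable_pi_iff.2 fun i => ?_
  refine Fin.cases ?_ (fun j => ?_) i
  · simpa using hf
  · simpa using (measurable_pi_iff.1 hg) j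

/-- A vector of independent Gamma variables is the product of its sum and an independent
vector with sum `1`. -/
theorem exists_lintegral_pi_gammaLaw (k : ℕ) (c : Fin k → ℝ) (hc : ∀ i, 0 ≤ c i)
    (hs : 0 < ∑ i, c i) :
    ∃ τ : Measure (Fin k → ℝ), IsProbabilityMeasure τ ∧ (∀ᵐ w ∂τ, ∑ i, w i = 1) ∧
      ∀ F : (Fin k → ℝ) → ℝ≥0∞, Measurable F →
        ∫⁻ z, F z ∂Measure.pi (fun i => gammaLaw (c i)) =
          ∫⁻ s, ∫⁻ w, F (s • w) ∂τ ∂gammaLaw (∑ i, c i) := by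
  induction k with
  | zero => simp at hs
  | succ k ih =>
    rw [Fin.sum_univ_succ] at hs ⊢
    have hsum : Measurable fun z : Fin (k + 1) → ℝ => ∑ i, z i := by fun_prop
    have hset : MeasurableSet {w : Fin (k + 1) → ℝ | ∑ i, w i = 1} :=
      hsum (measurableSet_singleton 1)
    rcases (Finset.sum_nonneg fun (i : Fin k) _ => hc i.succ).eq_or_lt with h0 | hpos
    -- All shapes but the first are zero, so the vector is its first coordinate times the first
    -- basis vector.
    · refine ⟨Measure.dirac (Fin.cons 1 0), inferInstance, ?_, fun F hF => ?_⟩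
      · rw [ae_dirac_iff hset]; simp [Fin.sum_univ_succ]
      · have hz : ∀ i : Fin k, c i.succ = 0 := fun i =>
          (Finset.sum_eq_zero_iff_of_nonneg fun (i : Fin k) _ => hc i.succ).1 h0.symm i
            (Finset.mem_univ i)
        rw [lintegral_pi_fin_succ _ hF, ← h0, add_zero]
        simp_rw [hz, pi_gammaLaw_zero]
        refine lintegral_congr fun x => ?_
        rw [lintegral_dirac' _ (by fun_prop), lintegral_dirac' _ (by fun_prop)]
        congr 1
        ext i
        refine Fin.cases ?_ (fun j => ?_) i <;> simp
    obtain ⟨τ, hτ, hτ1, hτF⟩ := ih (fun i => c i.succ) (fun i => hc _) hpos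
    rcases (hc 0).eq_or_lt with h0 | h0
    · refine ⟨τ.map (fun w => Fin.cons 0 w), Measure.isProbabilityMeasure_map (by fun_prop),
        ?_, fun F hF => ?_⟩
      · rw [ae_map_iff (by fun_prop) hset]
        filter_upwards [hτ1] with w hw
        simpa [Fin.sum_univ_succ] using hw
      · rw [lintegral_pi_fin_succ _ hF, ← h0, gammaLaw_zero, zero_add,
          lintegral_dirac' _ (Measurable.lintegral_prod_right'
            (f := fun p : ℝ × (Fin k → ℝ) => F (Fin.cons p.1 p.2)) (by fun_prop)),
          hτF _ (by fun_prop)]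
        refine lintegral_congr fun s => ?_
        rw [lintegral_map (by fun_prop) (by fun_prop)]
        refine lintegral_congr fun w => ?_
        congr 1
        ext i
        refine Fin.cases ?_ (fun j => ?_) i <;> simp
    have hβ := isProbabilityMeasureBeta h0 hpos
    -- Write the tail as `s' w` by induction. Beta-Gamma algebra turns the first coordinate and `s'`
    -- into `s t` and `s (1 - t)`, so the vector is `s (t, (1 - t) w)`.
    refine ⟨((betaMeasure (c 0) (∑ i : Fin k, c i.succ)).prod τ).map
      (fun p => Fin.cons p.1 ((1 - p.1) • p.2)),
      Measure.isProbabilityMeasure_map (by fun_prop), ?_, fun F hF => ?_⟩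
    · rw [ae_map_iff (by fun_prop) hset]
      have := Measure.quasiMeasurePreserving_snd (μ := betaMeasure (c 0) (∑ i : Fin k, c i.succ))
        (ν := τ) |>.ae hτ1
      filter_upwards [this] with p hp
      simp [Fin.sum_univ_succ, ← Finset.mul_sum, hp]
    · rw [lintegral_pi_fin_succ _ hF]
      have h1 : ∀ x, ∫⁻ z, F (Fin.cons x z) ∂Measure.pi (fun i : Fin k => gammaLaw (c i.succ)) =
          ∫⁻ s, ∫⁻ w, F (Fin.cons x (s • w)) ∂τ ∂gammaLaw (∑ i : Fin k, c i.succ) :=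
        fun x => hτF (fun z => F (Fin.cons x z)) (by fun_prop)
      simp_rw [h1]
      rw [lintegral_lintegral_gammaLaw
        (F := fun x s => ∫⁻ w, F (Fin.cons x (s • w)) ∂τ) h0 hpos (Measurable.lintegral_prod_right'
          (f := fun p : (ℝ × ℝ) × (Fin k → ℝ) => F (Fin.cons p.1.1 (p.1.2 • p.2)))
          (by fun_prop))]
      refine lintegral_congr fun s => ?_
      rw [lintegral_map (by fun_prop) (by fun_prop), lintegral_prod _ (by fun_prop)]
      refine lintegral_congr fun t => lintegral_congr fun w => ?_
      congr 1
      ext i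
      refine Fin.cases ?_ (fun j => ?_) i <;> simp [mul_assoc]

/-! ### The Dirichlet distribution and its Beta mixtures. -/

theorem measurable_div_sum {ι : Type*} [Fintype ι] :
    Measurable fun (z : ι → ℝ) i => z i / ∑ j, z j := by fun_prop

instance isProbabilityMeasure_dirichletMeasure {ι : Type*} [Fintype ι] (c : ι → ℝ) :
    IsProbabilityMeasure (dirichletMeasure c) :=
  Measure.isProbabilityMeasure_map measurable_div_sum.aemeasurable

theorem lintegral_dirichletMeasure {ι : Type*} [Fintype ι] (c : ι → ℝ) {f : (ι → ℝ) → ℝ≥0∞}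
    (hf : Measurable f) :
    ∫⁻ v, f v ∂dirichletMeasure c =
      ∫⁻ z, f (fun i => z i / ∑ j, z j) ∂Measure.pi fun i => gammaLaw (c i) :=
  lintegral_map hf measurable_div_sum

theorem ae_dirichletMeasure_nonneg {ι : Type*} [Fintype ι] {c : ι → ℝ} (hc : ∀ i, 0 ≤ c i) :
    ∀ᵐ v ∂dirichletMeasure c, ∀ i, 0 ≤ v i := by
  have hset : MeasurableSet {v : ι → ℝ | ∀ i, 0 ≤ v i} := by
    simp only [Set.ofPred_forall]
    exact MeasurableSet.iInter fun i => measurableSet_le measurable_const (measurable_pi_apply i)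
  rw [dirichletMeasure, ae_map_iff measurable_div_sum.aemeasurable hset]
  have : ∀ᵐ z ∂Measure.pi (fun i => gammaLaw (c i)), ∀ i, 0 ≤ z i :=
    ae_all_iff.2 fun i =>
      (measurePreserving_eval (fun i => gammaLaw (c i)) i).quasiMeasurePreserving.ae
      (ae_gammaLaw_nonneg (hc i))
  filter_upwards [this] with z hz i
  exact div_nonneg (hz i) (Finset.sum_nonneg fun j _ => hz j)

/-- A law of probability vectors that factors a vector of independent Gamma variables is the
Dirichlet distribution. -/
theorem dirichletMeasure_eq_of_lintegral {ι : Type*} [Fintype ι] {c : ι → ℝ} {a : ℝ} (ha : 0 < a)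
    {τ : Measure (ι → ℝ)} [IsProbabilityMeasure τ] (hτ : ∀ᵐ w ∂τ, ∑ i, w i = 1)
    (h : ∀ F : (ι → ℝ) → ℝ≥0∞, Measurable F →
      ∫⁻ z, F z ∂Measure.pi (fun i => gammaLaw (c i)) =
        ∫⁻ s, ∫⁻ w, F (s • w) ∂τ ∂gammaLaw a) :
    dirichletMeasure c = τ := by
  refine Measure.ext_of_lintegral _ fun f hf => ?_
  rw [lintegral_dirichletMeasure c hf,
    h (fun z => f fun i => z i / ∑ j, z j) (hf.comp measurable_div_sum)]
  -- Normalizing `s w` gives back `w` when `s > 0` and `∑ w = 1`.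
  have : ∀ᵐ s ∂gammaLaw a,
      ∫⁻ w, f (fun i => (s • w) i / ∑ j, (s • w) j) ∂τ = ∫⁻ w, f w ∂τ := by
    filter_upwards [ae_gammaLaw_pos ha] with s hs
    refine lintegral_congr_ae ?_
    filter_upwards [hτ] with w hw
    congr 1
    ext i
    simp only [Pi.smul_apply, smul_eq_mul, ← Finset.mul_sum, hw, mul_one]
    field_simp
  rw [lintegral_congr_ae this]
  simp

theorem ae_sum_dirichletMeasure {k : ℕ} {c : Fin k → ℝ} (hc : ∀ i, 0 ≤ c i)
    (hs : 0 < ∑ i, c i) : ∀ᵐ v ∂dirichletMeasure c, ∑ i, v i = 1 := by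
  obtain ⟨τ, _, hτ, h⟩ := exists_lintegral_pi_gammaLaw k c hc hs
  rwa [dirichletMeasure_eq_of_lintegral hs hτ h]

theorem lintegral_pi_gammaLaw {k : ℕ} {c : Fin k → ℝ} (hc : ∀ i, 0 ≤ c i)
    (hs : 0 < ∑ i, c i) {F : (Fin k → ℝ) → ℝ≥0∞} (hF : Measurable F) :
    ∫⁻ z, F z ∂Measure.pi (fun i => gammaLaw (c i)) =
      ∫⁻ s, ∫⁻ w, F (s • w) ∂dirichletMeasure c ∂gammaLaw (∑ i, c i) := by
  obtain ⟨τ, _, hτ, h⟩ := exists_lintegral_pi_gammaLaw k c hc hs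
  rw [dirichletMeasure_eq_of_lintegral hs hτ h]
  exact h F hF

/-- A Beta mixture of two independent Dirichlet vectors is a Dirichlet vector. -/
theorem lintegral_beta_mixture_dirichletMeasure {k : ℕ} {b c : Fin k → ℝ} (hb : ∀ i, 0 ≤ b i)
    (hc : ∀ i, 0 ≤ c i) (hbs : 0 < ∑ i, b i) (hcs : 0 < ∑ i, c i)
    {f : (Fin k → ℝ) → ℝ≥0∞} (hf : Measurable f) :
    ∫⁻ t, ∫⁻ u, ∫⁻ v, f (t • u + (1 - t) • v) ∂dirichletMeasure c ∂dirichletMeasure b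
        ∂betaMeasure (∑ i, b i) (∑ i, c i) =
      ∫⁻ v, f v ∂dirichletMeasure (b + c) := by
  have hβ := isProbabilityMeasureBeta hbs hcs
  let τ : Measure (Fin k → ℝ) := ((betaMeasure (∑ i, b i) (∑ i, c i)).prod
    ((dirichletMeasure b).prod (dirichletMeasure c))).map
      fun p => p.1 • p.2.1 + (1 - p.1) • p.2.2
  have hτp : IsProbabilityMeasure τ := Measure.isProbabilityMeasure_map (by fun_prop)
  have hτF : ∀ F : (Fin k → ℝ) → ℝ≥0∞, Measurable F → ∫⁻ w, F w ∂τ =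
      ∫⁻ t, ∫⁻ u, ∫⁻ v, F (t • u + (1 - t) • v) ∂dirichletMeasure c ∂dirichletMeasure b
        ∂betaMeasure (∑ i, b i) (∑ i, c i) := by
    intro F hF
    rw [lintegral_map hF (by fun_prop), lintegral_prod _ (by fun_prop)]
    refine lintegral_congr fun t => ?_
    rw [lintegral_prod _ (by fun_prop)]
  rw [← hτF f hf]
  congr 1
  symm
  have hset : MeasurableSet {w : Fin k → ℝ | ∑ i, w i = 1} :=
    (by fun_prop : Measurable fun z : Fin k → ℝ => ∑ i, z i) (measurableSet_singleton 1)
  refine dirichletMeasure_eq_of_lintegral (add_pos hbs hcs) ?_ fun F hF => ?_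
  · rw [ae_map_iff (by fun_prop) hset]
    have h1 := (Measure.quasiMeasurePreserving_snd (μ := betaMeasure (∑ i, b i) (∑ i, c i))
      (ν := (dirichletMeasure b).prod (dirichletMeasure c))).ae
        (Measure.quasiMeasurePreserving_fst.ae (ae_sum_dirichletMeasure hb hbs))
    have h2 := (Measure.quasiMeasurePreserving_snd (μ := betaMeasure (∑ i, b i) (∑ i, c i))
      (ν := (dirichletMeasure b).prod (dirichletMeasure c))).ae
        (Measure.quasiMeasurePreserving_snd.ae (ae_sum_dirichletMeasure hc hcs))
    filter_upwards [h1, h2] with p hp1 hp2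
    simp [Finset.sum_add_distrib, ← Finset.mul_sum, hp1, hp2]
  -- A Gamma vector with shapes `b + c` is a sum of independent ones, `r u + s v` with `r`, `s` the
  -- Gamma totals. Beta-Gamma algebra applied to `(r, s)` extracts the common total and leaves `t u
  -- + (1 - t) v`.
  · have e1 : ∀ y : Fin k → ℝ, ∫⁻ z, F (y + z) ∂Measure.pi (fun i => gammaLaw (c i)) =
        ∫⁻ s, ∫⁻ v, F (y + s • v) ∂dirichletMeasure c ∂gammaLaw (∑ i, c i) :=
      fun y => lintegral_pi_gammaLaw hc hcs (F := fun z => F (y + z)) (by fun_prop)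
    have e2 : ∀ r : ℝ, ∫⁻ u, ∫⁻ s, ∫⁻ v, F (r • u + s • v) ∂dirichletMeasure c
          ∂gammaLaw (∑ i, c i) ∂dirichletMeasure b =
        ∫⁻ s, ∫⁻ u, ∫⁻ v, F (r • u + s • v) ∂dirichletMeasure c
          ∂dirichletMeasure b ∂gammaLaw (∑ i, c i) := by
      intro r
      refine lintegral_lintegral_swap (Measurable.aemeasurable ?_)
      exact Measurable.lintegral_prod_right'
        (f := fun p : ((Fin k → ℝ) × ℝ) × (Fin k → ℝ) => F (r • p.1.1 + p.1.2 • p.2))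
        (by fun_prop)
    have m1 : Measurable fun y : Fin k → ℝ =>
        ∫⁻ s, ∫⁻ v, F (y + s • v) ∂dirichletMeasure c ∂gammaLaw (∑ i, c i) := by
      refine Measurable.lintegral_prod_right' (f := fun p : (Fin k → ℝ) × ℝ =>
        ∫⁻ v, F (p.1 + p.2 • v) ∂dirichletMeasure c) ?_
      exact Measurable.lintegral_prod_right'
        (f := fun p : ((Fin k → ℝ) × ℝ) × (Fin k → ℝ) => F (p.1.1 + p.1.2 • p.2))
        (by fun_prop)
    have m2 : Measurable (Function.uncurry fun r s : ℝ =>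
        ∫⁻ u, ∫⁻ v, F (r • u + s • v) ∂dirichletMeasure c ∂dirichletMeasure b) := by
      refine Measurable.lintegral_prod_right' (f := fun p : (ℝ × ℝ) × (Fin k → ℝ) =>
        ∫⁻ v, F (p.1.1 • p.2 + p.1.2 • v) ∂dirichletMeasure c) ?_
      exact Measurable.lintegral_prod_right' (f := fun p : ((ℝ × ℝ) × (Fin k → ℝ)) × (Fin k → ℝ) =>
        F (p.1.1.1 • p.1.2 + p.1.1.2 • p.2)) (by fun_prop)
    have := lintegral_pi_gammaLaw_add hb hc hF
    simp only [Pi.add_apply]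
    rw [← this]
    simp_rw [e1]
    rw [lintegral_pi_gammaLaw hb hbs m1]
    simp_rw [e2]
    rw [lintegral_lintegral_gammaLaw hbs hcs m2]
    refine lintegral_congr fun s => ?_
    rw [hτF _ (by fun_prop)]
    simp only [smul_add, smul_smul]

/-! ### Aggregation of Dirichlet components. -/

/-- The coordinates other than `j` have shape `0`, hence are constantly `0` and independent of
everything. This lets a single Gamma variable enter the additivity of Gamma vectors. -/
theorem map_smul_single_gammaLaw {ι : Type*} [Fintype ι] [DecidableEq ι] (d : ℝ) (j : ι) :
    (gammaLaw d).map (fun x => x • (Pi.single j 1 : ι → ℝ)) =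
      Measure.pi fun i => gammaLaw ((d • (Pi.single j 1 : ι → ℝ)) i) := by
  symm
  refine Measure.pi_eq fun s hs => ?_
  rw [Measure.map_apply (by fun_prop) (MeasurableSet.univ_pi hs),
    ← Finset.mul_prod_erase _ _ (Finset.mem_univ j)]
  have h0 : ∀ i ∈ Finset.univ.erase j, gammaLaw ((d • (Pi.single j 1 : ι → ℝ)) i) (s i) =
      (s i).indicator 1 0 := by
    intro i hi
    have : i ≠ j := Finset.ne_of_mem_erase hi
    simp [this, gammaLaw_zero, Measure.dirac_apply' _ (hs i)]
  rw [Finset.prod_congr rfl h0]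
  by_cases h : ∀ i ≠ j, (0 : ℝ) ∈ s i
  · rw [Finset.prod_eq_one fun i hi => by simp [h i (Finset.ne_of_mem_erase hi)]]
    simp only [Pi.smul_apply, Pi.single_eq_same, smul_eq_mul, mul_one]
    congr 1
    ext x
    simp only [Set.mem_preimage, Set.mem_pi, Set.mem_univ, forall_true_left, Pi.smul_apply,
      smul_eq_mul]
    refine ⟨fun hx => by simpa using hx j, fun hx i => ?_⟩
    by_cases hi : i = j
    · subst hi; simpa using hx
    · simpa [hi] using h i hi
  · push Not at h
    obtain ⟨i, hij, hi⟩ := h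
    rw [Finset.prod_eq_zero (i := i) (by simp [hij]) (by simp [hi]), mul_zero]
    convert measure_empty (μ := gammaLaw d)
    refine Set.eq_empty_of_forall_notMem fun x hx => hi ?_
    simpa [hij] using hx i (Set.mem_univ i)

/-- Independent Gamma variables are grouped by their labels `y i`, and shapes add within a label. A
label that does not occur gets shape `0`, which is why degenerate shapes must be allowed. -/
theorem lintegral_pi_gammaLaw_sum_single {ι : Type*} [Fintype ι] [DecidableEq ι] (n : ℕ)
    (d : Fin n → ℝ) (hd : ∀ i, 0 ≤ d i) (y : Fin n → ι) {F : (ι → ℝ) → ℝ≥0∞}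
    (hF : Measurable F) :
    ∫⁻ z, F (∑ i, z i • Pi.single (y i) 1) ∂Measure.pi (fun i => gammaLaw (d i)) =
      ∫⁻ z, F z ∂Measure.pi
        (fun j => gammaLaw ((∑ i, d i • (Pi.single (y i) 1 : ι → ℝ)) j)) := by
  induction n generalizing F with
  | zero =>
    simp [pi_gammaLaw_zero, lintegral_dirac' _ hF]
  | succ n ih =>
    rw [lintegral_pi_fin_succ _ (by fun_prop)]
    simp only [Fin.sum_univ_succ, Fin.cons_zero, Fin.cons_succ]
    have h1 : ∀ x : ℝ, ∫⁻ z, F (x • Pi.single (y 0) 1 + ∑ i, z i • Pi.single (y i.succ) 1)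
        ∂Measure.pi (fun i : Fin n => gammaLaw (d i.succ)) =
        ∫⁻ z, F (x • Pi.single (y 0) 1 + z) ∂Measure.pi
        (fun j => gammaLaw ((∑ i : Fin n, d i.succ • (Pi.single (y i.succ) 1 : ι → ℝ)) j)) :=
      fun x => ih (fun i => d i.succ) (fun i => hd _) (fun i => y i.succ)
        (F := fun z => F (x • Pi.single (y 0) 1 + z)) (by fun_prop)
    simp_rw [h1]
    have hnn : ∀ (d' : ℝ), 0 ≤ d' → ∀ (l j : ι), 0 ≤ (d' • (Pi.single l 1 : ι → ℝ)) j := by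
      intro d' hd' l j
      simp only [Pi.smul_apply, smul_eq_mul, Pi.single_apply]
      split_ifs <;> simp [hd']
    have h2 := lintegral_pi_gammaLaw_add (b := d 0 • (Pi.single (y 0) 1 : ι → ℝ))
      (c := ∑ i : Fin n, d i.succ • (Pi.single (y i.succ) 1 : ι → ℝ)) (hnn _ (hd 0) _)
      (fun j => by rw [Finset.sum_apply]; exact Finset.sum_nonneg fun i _ => hnn _ (hd _) _ _) hF
    simp only [Pi.add_apply]
    rw [← h2, ← map_smul_single_gammaLaw, lintegral_map (Measurable.lintegral_prod_right'
      (f := fun p : (ι → ℝ) × (ι → ℝ) => F (p.1 + p.2)) (by fun_prop)) (by fun_prop)]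

/-- The aggregation property of the Dirichlet distribution. -/
theorem lintegral_dirichletMeasure_sum_single {ι : Type*} [Fintype ι] [DecidableEq ι] {n : ℕ}
    {d : Fin n → ℝ} (hd : ∀ i, 0 ≤ d i) (y : Fin n → ι) {F : (ι → ℝ) → ℝ≥0∞}
    (hF : Measurable F) :
    ∫⁻ q, F (∑ i, q i • Pi.single (y i) 1) ∂dirichletMeasure d =
      ∫⁻ z, F z ∂dirichletMeasure (∑ i, d i • (Pi.single (y i) 1 : ι → ℝ)) := by
  rw [lintegral_dirichletMeasure _ (by fun_prop), lintegral_dirichletMeasure _ hF,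
    ← lintegral_pi_gammaLaw_sum_single n d hd y
      (F := fun z => F fun i => z i / ∑ j, z j) (hF.comp measurable_div_sum)]
  refine lintegral_congr fun z => ?_
  have : ∑ j, (∑ i, z i • (Pi.single (y i) 1 : ι → ℝ)) j = ∑ i, z i := by
    simp only [Finset.sum_apply]
    rw [Finset.sum_comm]
    simp [Pi.single_apply]
  simp only [this]
  congr 1
  ext j
  simp [Finset.sum_apply, Finset.sum_div, div_mul_eq_mul_div]

/-! ### Size-biasing and one-point updates. -/

/-- Multiplying the density by `x` raises the exponent by one, and `Γ(c + 1) = c Γ(c)` gives the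
constant. -/
theorem gammaLaw_add_one {c : ℝ} (hc : 0 < c) :
    gammaLaw (c + 1) = (gammaLaw c).withDensity fun x => ENNReal.ofReal (x / c) := by
  rw [gammaLaw_of_pos hc, gammaLaw_of_pos (by positivity), gammaMeasure, gammaMeasure,
    ← withDensity_mul _ (measurable_gammaPDF _ _) (by fun_prop)]
  congr 1
  ext x
  rcases lt_or_ge x 0 with hx | hx
  · simp [gammaPDF_of_neg hx]
  rw [Pi.mul_apply, gammaPDF_of_nonneg hx, gammaPDF_of_nonneg hx]
  have hG := Real.Gamma_pos_of_pos hc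
  rw [← ENNReal.ofReal_mul (by positivity), Real.Gamma_add_one hc.ne']
  congr 1
  rcases hx.eq_or_lt with rfl | hx
  · simp [Real.zero_rpow hc.ne']
  rw [show c + 1 - 1 = (c - 1) + 1 by ring, Real.rpow_add hx, Real.rpow_one]
  simp only [Real.one_rpow]
  field_simp

/-- The mean of the Gamma law, read off from the total mass of its size-biased version. -/
theorem lintegral_ofReal_div_gammaLaw {c : ℝ} (hc : 0 < c) :
    ∫⁻ x, ENNReal.ofReal (x / c) ∂gammaLaw c = 1 := by
  have h := measure_univ (μ := gammaLaw (c + 1))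
  rwa [gammaLaw_add_one hc, withDensity_apply _ MeasurableSet.univ, Measure.restrict_univ] at h

/-- Only the factor with index `j` of the product is size-biased. If `c j = 0`, both sides vanish
because `z j = 0` almost surely. -/
theorem lintegral_pi_gammaLaw_size_bias {k : ℕ} {c : Fin k → ℝ} (hc : ∀ i, 0 ≤ c i) {a : ℝ}
    (ha : 0 < a) (j : Fin k) {F : (Fin k → ℝ) → ℝ≥0∞} (hF : Measurable F) :
    ENNReal.ofReal (c j / a) *
        ∫⁻ z, F z ∂Measure.pi (fun i => gammaLaw ((c + (Pi.single j 1 : Fin k → ℝ)) i)) =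
      ∫⁻ z, ENNReal.ofReal (z j / a) * F z ∂Measure.pi (fun i => gammaLaw (c i)) := by
  obtain _ | k := k
  · exact j.elim0
  rw [lintegral_pi_insertNth _ j hF, lintegral_pi_insertNth _ j (by fun_prop)]
  have hm : Measurable fun x : ℝ => ∫⁻ z, F (j.insertNth x z)
      ∂Measure.pi (fun i => gammaLaw (c (j.succAbove i))) := by
    refine Measurable.lintegral_prod_right' (f := fun p : ℝ × (Fin k → ℝ) =>
      F (j.insertNth p.1 p.2)) ?_
    exact hF.comp (MeasurableEquiv.piFinSuccAbove (fun _ => ℝ) j).symm.measurable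
  simp only [Pi.add_apply, Pi.single_eq_same, Fin.insertNth_apply_same, ne_eq,
    Fin.succAbove_ne, not_false_eq_true, Pi.single_eq_of_ne, add_zero]
  simp_rw [lintegral_const_mul' _ _ ENNReal.ofReal_ne_top]
  rcases (hc j).eq_or_lt with h | h
  · rw [← h, gammaLaw_zero, lintegral_dirac' _ (by fun_prop)]
    simp
  · rw [gammaLaw_add_one h, lintegral_withDensity_eq_lintegral_mul _ (by fun_prop) hm,
      ← lintegral_const_mul' _ _ ENNReal.ofReal_ne_top]
    refine lintegral_congr fun x => ?_
    rw [Pi.mul_apply, ← mul_assoc, ← ENNReal.ofReal_mul (by positivity)]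
    congr 2
    field_simp

/-- The Dirichlet distribution is the mixture of its one-point updates. -/
theorem sum_lintegral_dirichletMeasure_add_single {k : ℕ} {c : Fin k → ℝ} (hc : ∀ i, 0 ≤ c i)
    (hs : 0 < ∑ i, c i) {f : (Fin k → ℝ) → ℝ≥0∞} (hf : Measurable f) :
    ∑ j, ENNReal.ofReal (c j / ∑ i, c i) *
        ∫⁻ v, f v ∂dirichletMeasure (c + Pi.single j 1) = ∫⁻ v, f v ∂dirichletMeasure c := by
  have hm : Measurable fun z : Fin k → ℝ => f fun i => z i / ∑ j, z j :=
    hf.comp measurable_div_sum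
  have h1 : ∀ j, ENNReal.ofReal (c j / ∑ i, c i) *
      ∫⁻ v, f v ∂dirichletMeasure (c + Pi.single j 1) =
      ∫⁻ z, ENNReal.ofReal (z j / ∑ i, c i) * f (fun i => z i / ∑ j, z j)
        ∂Measure.pi (fun i => gammaLaw (c i)) := by
    intro j
    rw [lintegral_dirichletMeasure _ hf, lintegral_pi_gammaLaw_size_bias hc hs j hm]
  simp_rw [h1]
  rw [← lintegral_finsetSum _ (fun j _ => by fun_prop), lintegral_pi_gammaLaw hc hs (by fun_prop)]
  -- With `z = s w` and `∑ w = 1`, the weights `z j / ∑ c` add up to `s / ∑ c`, which has mean `1`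
  -- and is independent of `w`.
  have h2 : ∀ᵐ s ∂gammaLaw (∑ i, c i), (∫⁻ w, ∑ j, ENNReal.ofReal ((s • w) j / ∑ i, c i) *
      f (fun i => (s • w) i / ∑ j, (s • w) j) ∂dirichletMeasure c) =
      ENNReal.ofReal (s / ∑ i, c i) * ∫⁻ w, f w ∂dirichletMeasure c := by
    filter_upwards [ae_gammaLaw_pos hs] with s hs'
    rw [← lintegral_const_mul' _ _ ENNReal.ofReal_ne_top]
    refine lintegral_congr_ae ?_
    filter_upwards [ae_sum_dirichletMeasure hc hs, ae_dirichletMeasure_nonneg hc] with w hw hw0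
    rw [← Finset.sum_mul, ← ENNReal.ofReal_sum_of_nonneg (f := fun j => (s • w) j / ∑ i, c i)
      (fun j _ => div_nonneg (mul_nonneg hs'.le (hw0 j)) hs.le), ← Finset.sum_div]
    simp only [Pi.smul_apply, smul_eq_mul, ← Finset.mul_sum, hw, mul_one]
    congr 2
    ext i
    field_simp
  rw [lintegral_congr_ae h2, lintegral_mul_const _ (by fun_prop),
    lintegral_ofReal_div_gammaLaw hs, one_mul]

/-! ### The distributional equation for random vectors: uniqueness. -/

/-- The law of `θ W + (1 - θ) V` for `V ∼ κ` independent of `(θ, W)`. -/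
noncomputable def mixtureLaw {ι E : Type*} [MeasurableSpace E] (ν : Measure E)
    (T : E → ℝ) (W : E → ι → ℝ) (κ : Measure (ι → ℝ)) : Measure (ι → ℝ) :=
  (ν.prod κ).map fun p => T p.1 • W p.1 + (1 - T p.1) • p.2

theorem measurable_mixture_map {ι E : Type*} [MeasurableSpace E] {T : E → ℝ}
    {W : E → ι → ℝ} (hT : Measurable T) (hW : Measurable W) :
    Measurable fun p : E × (ι → ℝ) => T p.1 • W p.1 + (1 - T p.1) • p.2 := by
  refine measurable_pi_iff.2 fun i => ?_
  have hWi : Measurable fun e => W e i := (measurable_pi_apply i).comp hW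
  have h1 : Measurable fun p : E × (ι → ℝ) => T p.1 * W p.1 i :=
    (hT.comp measurable_fst).mul (hWi.comp measurable_fst)
  have h2 : Measurable fun p : E × (ι → ℝ) => (1 - T p.1) * p.2 i :=
    (measurable_const.sub (hT.comp measurable_fst)).mul
      ((measurable_pi_apply i).comp measurable_snd)
  exact h1.add h2

theorem lintegral_mixtureLaw {ι E : Type*} [MeasurableSpace E] (ν : Measure E)
    {T : E → ℝ} {W : E → ι → ℝ} (hT : Measurable T) (hW : Measurable W) (κ : Measure (ι → ℝ))
    [SFinite κ] {f : (ι → ℝ) → ℝ≥0∞} (hf : Measurable f) :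
    ∫⁻ v, f v ∂mixtureLaw ν T W κ = ∫⁻ e, ∫⁻ v, f (T e • W e + (1 - T e) • v) ∂κ ∂ν := by
  rw [mixtureLaw, lintegral_map hf (measurable_mixture_map hT hW),
    lintegral_prod (fun p : E × (ι → ℝ) => f (T p.1 • W p.1 + (1 - T p.1) • p.2))
      (hf.comp (measurable_mixture_map hT hW)).aemeasurable]

/-- Conditioning on `e` leaves a unimodular factor times the characteristic function of `κ` at the
shrunken functional `(1 - T e) • L`. The shrinking is what makes the equation contractive. -/
theorem charFunDual_mixtureLaw {ι E : Type*} [Fintype ι] [MeasurableSpace E] {ν : Measure E}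
    [IsProbabilityMeasure ν] {T : E → ℝ} {W : E → ι → ℝ} (hT : Measurable T) (hW : Measurable W)
    (κ : Measure (ι → ℝ)) [IsProbabilityMeasure κ] (L : StrongDual ℝ (ι → ℝ)) :
    charFunDual (mixtureLaw ν T W κ) L =
      ∫ e, Complex.exp ((T e * L (W e) : ℝ) * Complex.I) *
        charFunDual κ ((1 - T e) • L) ∂ν := by
  have hL : Measurable fun v => L v := L.continuous.measurable
  rw [charFunDual_apply, mixtureLaw, integral_map (measurable_mixture_map hT hW).aemeasurable
    (by fun_prop), integral_prod]
  · refine integral_congr_ae (ae_of_all _ fun e => ?_)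
    simp only
    rw [charFunDual_apply, ← integral_const_mul]
    refine integral_congr_ae (ae_of_all _ fun v => ?_)
    simp only [map_add, map_smul, smul_eq_mul, smul_apply]
    rw [← Complex.exp_add]
    congr 1
    push_cast
    ring
  · refine Integrable.of_bound (C := 1) (Measurable.aestronglyMeasurable (by fun_prop))
      (ae_of_all _ fun p => ?_)
    rw [Complex.norm_exp_ofReal_mul_I]

/-- From `|exp(ix) - 1| ≤ |x|`. A bound linear in `‖L‖` is needed, since the iteration gains its
factor from the norm of the functional. -/
theorem norm_charFunDual_sub_one_le {ι : Type*} [Fintype ι] {κ : Measure (ι → ℝ)}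
    [IsProbabilityMeasure κ] (hκ : ∀ᵐ v ∂κ, ‖v‖ ≤ 1) (L : StrongDual ℝ (ι → ℝ)) :
    ‖charFunDual κ L - 1‖ ≤ ‖L‖ := by
  have h1 : charFunDual κ L - 1 = ∫ v, (Complex.exp (L v * Complex.I) - 1) ∂κ := by
    rw [charFunDual_apply, integral_sub _ (integrable_const _)]
    · simp
    · refine Integrable.of_bound (C := 1) (Measurable.aestronglyMeasurable ?_)
        (ae_of_all _ fun p => ?_)
      · have hL : Measurable fun v => L v := L.continuous.measurable
        fun_prop
      · rw [Complex.norm_exp_ofReal_mul_I]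
  rw [h1]
  refine (norm_integral_le_of_norm_le_const (C := ‖L‖) ?_).trans (by simp)
  filter_upwards [hκ] with v hv
  rw [mul_comm]
  refine (Real.norm_exp_I_mul_ofReal_sub_one_le).trans ?_
  exact (L.le_opNorm v).trans (mul_le_of_le_one_right (norm_nonneg _) hv)

theorem integral_one_sub_lt_one {E : Type*} [MeasurableSpace E] {ν : Measure E}
    [IsProbabilityMeasure ν] {T : E → ℝ} (hT : Measurable T) (hT01 : ∀ᵐ e ∂ν, 0 < T e ∧ T e < 1) :
    ∫ e, (1 - T e) ∂ν < 1 := by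
  have hi : Integrable T ν := Integrable.of_bound (C := 1) hT.aestronglyMeasurable (by
    filter_upwards [hT01] with e he
    rw [Real.norm_of_nonneg he.1.le]
    exact he.2.le)
  rw [integral_sub (integrable_const _) hi]
  have : 0 < ∫ e, T e ∂ν := by
    rw [integral_pos_iff_support_of_nonneg_ae (by filter_upwards [hT01] with e he using he.1.le) hi]
    have : Function.support T =ᵐ[ν] Set.univ := by
      filter_upwards [hT01] with e he
      exact propext ⟨fun _ => trivial, fun _ => he.1.ne'⟩
    rw [measure_congr this]
    simp
  simp only [integral_const, probReal_univ, smul_eq_mul, mul_one]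
  linarith

/-- The distributional equation `V =_d θ W + (1 - θ) V` has at most one solution among the laws on
the unit ball. -/
theorem eq_of_eq_mixtureLaw {ι E : Type*} [Fintype ι] [MeasurableSpace E] {ν : Measure E}
    [IsProbabilityMeasure ν] {T : E → ℝ} {W : E → ι → ℝ} (hT : Measurable T) (hW : Measurable W)
    (hT01 : ∀ᵐ e ∂ν, 0 < T e ∧ T e < 1) {κ₁ κ₂ : Measure (ι → ℝ)} [IsProbabilityMeasure κ₁]
    [IsProbabilityMeasure κ₂] (hκ₁ : ∀ᵐ v ∂κ₁, ‖v‖ ≤ 1) (hκ₂ : ∀ᵐ v ∂κ₂, ‖v‖ ≤ 1)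
    (h₁ : κ₁ = mixtureLaw ν T W κ₁) (h₂ : κ₂ = mixtureLaw ν T W κ₂) : κ₁ = κ₂ := by
  set r := ∫ e, (1 - T e) ∂ν with hr
  have hr1 : r < 1 := integral_one_sub_lt_one hT hT01
  have hr0 : 0 ≤ r := integral_nonneg_of_ae (by
    filter_upwards [hT01] with e he
    simpa using he.2.le)
  have hi : Integrable (fun e => 1 - T e) ν :=
    Integrable.of_bound (C := 1) (by fun_prop) (by
      filter_upwards [hT01] with e he
      rw [Real.norm_of_nonneg (by linarith)]
      linarith)
  have hint : ∀ (κ : Measure (ι → ℝ)) [IsProbabilityMeasure κ] (L : StrongDual ℝ (ι → ℝ)),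
      Integrable (fun e => Complex.exp ((T e * L (W e) : ℝ) * Complex.I) *
        charFunDual κ ((1 - T e) • L)) ν := by
    intro κ _ L
    have hL : Measurable fun v => L v := L.continuous.measurable
    refine Integrable.of_bound (C := 1) (AEStronglyMeasurable.mul
      (Measurable.aestronglyMeasurable (by fun_prop)) ?_) (ae_of_all _ fun e => ?_)
    · simp only [charFunDual_apply]
      refine StronglyMeasurable.aestronglyMeasurable ?_
      refine StronglyMeasurable.integral_prod_right (f := fun e v =>
        Complex.exp ((((1 - T e) • L) v : ℝ) * Complex.I)) ?_
      refine Measurable.stronglyMeasurable ?_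
      simp only [smul_apply, smul_eq_mul, Function.uncurry_def]
      fun_prop
    · rw [norm_mul, Complex.norm_exp_ofReal_mul_I, one_mul]
      rw [charFunDual_apply]
      refine (norm_integral_le_of_norm_le_const (C := 1) (ae_of_all _ fun v => ?_)).trans (by simp)
      rw [Complex.norm_exp_ofReal_mul_I]
  -- The constant `2` counts one bound by `‖L‖` for each law. Each use of the equation replaces
  -- `‖L‖` by the average of `(1 - T e) ‖L‖`, which is `r ‖L‖`.
  have key : ∀ (m : ℕ) (L : StrongDual ℝ (ι → ℝ)),
      ‖charFunDual κ₁ L - charFunDual κ₂ L‖ ≤ 2 * r ^ m * ‖L‖ := by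
    intro m
    induction m with
    | zero =>
      intro L
      have e1 := norm_charFunDual_sub_one_le hκ₁ L
      have e2 := norm_charFunDual_sub_one_le hκ₂ L
      calc _ = ‖(charFunDual κ₁ L - 1) - (charFunDual κ₂ L - 1)‖ := by congr 1; ring
        _ ≤ ‖charFunDual κ₁ L - 1‖ + ‖charFunDual κ₂ L - 1‖ := norm_sub_le _ _
        _ ≤ _ := by simp; linarith
    | succ m ih =>
      intro L
      have e1 : charFunDual κ₁ L = _ :=
        (congrArg (fun κ => charFunDual κ L) h₁).trans (charFunDual_mixtureLaw hT hW κ₁ L)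
      have e2 : charFunDual κ₂ L = _ :=
        (congrArg (fun κ => charFunDual κ L) h₂).trans (charFunDual_mixtureLaw hT hW κ₂ L)
      rw [e1, e2, ← integral_sub (hint κ₁ L) (hint κ₂ L)]
      calc _ ≤ ∫ e, 2 * r ^ m * ‖L‖ * (1 - T e) ∂ν := by
            refine norm_integral_le_of_norm_le (hi.const_mul _) ?_
            filter_upwards [hT01] with e he
            rw [← mul_sub, norm_mul, Complex.norm_exp_ofReal_mul_I, one_mul]
            refine (ih _).trans (le_of_eq ?_)
            rw [norm_smul, Real.norm_of_nonneg (by linarith)]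
            ring
        _ = 2 * r ^ (m + 1) * ‖L‖ := by rw [integral_const_mul, ← hr]; ring
  refine Measure.ext_of_charFunDual (funext fun L => ?_)
  rw [← sub_eq_zero, ← norm_le_zero_iff]
  have hlim : Filter.Tendsto (fun m : ℕ => 2 * r ^ m * ‖L‖) Filter.atTop (nhds 0) := by
    have := ((tendsto_pow_atTop_nhds_zero_of_lt_one hr0 hr1).const_mul 2).mul_const ‖L‖
    simpa using this
  exact ge_of_tendsto' hlim fun m => key m L

theorem norm_le_one_of_sum_eq_one {ι : Type*} [Fintype ι] {v : ι → ℝ} (h0 : ∀ i, 0 ≤ v i)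
    (h1 : ∑ i, v i = 1) : ‖v‖ ≤ 1 := by
  refine (pi_norm_le_iff_of_nonneg zero_le_one).2 fun i => ?_
  rw [Real.norm_of_nonneg (h0 i), ← h1]
  exact Finset.single_le_sum (fun j _ => h0 j) (Finset.mem_univ i)

/-! ### The Dirichlet distribution as a solution. -/

/-- The law of the parameters `(θ, q, y)` of the mixture, for points `y` of law `ρ`. -/
noncomputable def mixtureParamLaw {X : Type*} [MeasurableSpace X] {n : ℕ} (a : ℝ)
    (ρ : Measure (Fin n → X)) : Measure (ℝ × (Fin n → ℝ) × (Fin n → X)) :=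
  (betaMeasure n a).prod ((dirichletMeasure fun _ => 1).prod ρ)

/-- If the updates of a Dirichlet distribution by the counts of `y ∼ ρ` average to the Dirichlet
distribution itself, then it solves the distributional equation. -/
theorem dirichletMeasure_eq_mixtureLaw {X : Type*} [MeasurableSpace X] {n k : ℕ} (hn : 1 ≤ n)
    {c : Fin k → ℝ} (hc : ∀ i, 0 ≤ c i) (hs : 0 < ∑ i, c i) {ρ : Measure (Fin n → X)}
    [IsProbabilityMeasure ρ] {cell : X → Fin k} (hcell : Measurable cell)
    (hρ : ∀ f : (Fin k → ℝ) → ℝ≥0∞, Measurable f →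
      ∫⁻ y, ∫⁻ v, f v ∂dirichletMeasure (c + ∑ i, Pi.single (cell (y i)) 1) ∂ρ =
        ∫⁻ v, f v ∂dirichletMeasure c) :
    dirichletMeasure c = mixtureLaw (mixtureParamLaw (∑ i, c i) ρ) (fun e => e.1)
      (fun e => ∑ i, e.2.1 i • Pi.single (cell (e.2.2 i)) 1) (dirichletMeasure c) := by
  have hn' : (0 : ℝ) < n := by exact_mod_cast hn
  have hβ := isProbabilityMeasureBeta hn' hs
  have hsingle : Measurable fun j : Fin k => (Pi.single j 1 : Fin k → ℝ) := Measurable.of_discrete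
  have hW : Measurable fun e : (Fin n → ℝ) × (Fin n → X) =>
      ∑ i, e.1 i • (Pi.single (cell (e.2 i)) 1 : Fin k → ℝ) := by
    refine Finset.measurable_sum _ fun i _ => Measurable.smul
      ((measurable_pi_apply i).comp measurable_fst) ?_
    exact hsingle.comp (hcell.comp (by fun_prop))
  refine Measure.ext_of_lintegral _ fun f hf => ?_
  have hWe : Measurable fun e : ℝ × (Fin n → ℝ) × (Fin n → X) =>
      ∑ i, e.2.1 i • (Pi.single (cell (e.2.2 i)) 1 : Fin k → ℝ) := hW.comp measurable_snd
  have hmap := measurable_mixture_map (T := fun e : ℝ × (Fin n → ℝ) × (Fin n → X) => e.1)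
    measurable_fst hWe
  unfold mixtureParamLaw
  rw [lintegral_mixtureLaw _ measurable_fst hWe _ hf]
  have m1 : Measurable fun e : ℝ × (Fin n → ℝ) × (Fin n → X) => ∫⁻ v,
      f (e.1 • (∑ i, e.2.1 i • (Pi.single (cell (e.2.2 i)) 1 : Fin k → ℝ)) + (1 - e.1) • v)
        ∂dirichletMeasure c := Measurable.lintegral_prod_right' (hf.comp hmap)
  rw [lintegral_prod _ m1.aemeasurable]
  -- The integral over `y` is moved outermost, so that the rest is a computation for fixed points.
  have e1 : ∀ t : ℝ, ∫⁻ z, ∫⁻ v, f (t • (∑ i, z.1 i • (Pi.single (cell (z.2 i)) 1 : Fin k → ℝ)) +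
      (1 - t) • v) ∂dirichletMeasure c ∂(dirichletMeasure fun _ => 1).prod ρ =
      ∫⁻ y, ∫⁻ q, ∫⁻ v, f (t • (∑ i, q i • (Pi.single (cell (y i)) 1 : Fin k → ℝ)) +
      (1 - t) • v) ∂dirichletMeasure c ∂(dirichletMeasure fun _ => 1) ∂ρ := by
    intro t
    have m1t : Measurable fun z : (Fin n → ℝ) × (Fin n → X) =>
        ∫⁻ v, f (t • (∑ i, z.1 i • (Pi.single (cell (z.2 i)) 1 : Fin k → ℝ)) +
          (1 - t) • v) ∂dirichletMeasure c := m1.comp (measurable_const.prodMk measurable_id)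
    exact lintegral_prod_symm _ m1t.aemeasurable
  rw [lintegral_congr e1]
  have m2 : Measurable fun e : ℝ × (Fin n → X) =>
      ∫⁻ q, ∫⁻ v, f (e.1 • (∑ i, q i • (Pi.single (cell (e.2 i)) 1 : Fin k → ℝ)) +
      (1 - e.1) • v) ∂dirichletMeasure c ∂(dirichletMeasure fun _ => 1) :=
    Measurable.lintegral_prod_right' (f := fun p : (ℝ × (Fin n → X)) × (Fin n → ℝ) =>
      ∫⁻ v, f (p.1.1 • (∑ i, p.2 i • (Pi.single (cell (p.1.2 i)) 1 : Fin k → ℝ)) +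
      (1 - p.1.1) • v) ∂dirichletMeasure c) (m1.comp (by fun_prop :
        Measurable fun p : (ℝ × (Fin n → X)) × (Fin n → ℝ) => (p.1.1, p.2, p.1.2)))
  rw [lintegral_lintegral_swap m2.aemeasurable, ← hρ f hf]
  refine lintegral_congr fun y => ?_
  -- Cell counts of the fixed points. Aggregation makes the weight vector `Dirichlet(N)`, and `∑ N =
  -- n` matches the first Beta parameter, so the mixture is `Dirichlet(N + c)`.
  set N : Fin k → ℝ := ∑ i, Pi.single (cell (y i)) 1 with hN
  have hN0 : ∀ j, 0 ≤ N j := fun j => by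
    rw [hN, Finset.sum_apply]
    refine Finset.sum_nonneg fun i _ => ?_
    rw [Pi.single_apply]
    split_ifs <;> simp
  have hNs : ∑ j, N j = n := by
    simp only [hN, Finset.sum_apply]
    rw [Finset.sum_comm]
    simp [Pi.single_apply]
  have h := lintegral_beta_mixture_dirichletMeasure hN0 hc (by rw [hNs]; exact hn') hs hf
  rw [add_comm c N, ← h, hNs]
  refine lintegral_congr fun t => ?_
  have m3 : Measurable fun u : Fin k → ℝ =>
      ∫⁻ v, f (t • u + (1 - t) • v) ∂dirichletMeasure c :=
    Measurable.lintegral_prod_right'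
      (f := fun p : (Fin k → ℝ) × (Fin k → ℝ) => f (t • p.1 + (1 - t) • p.2)) (by fun_prop)
  have h2 := lintegral_dirichletMeasure_sum_single (d := fun _ : Fin n => 1)
    (fun _ => zero_le_one) (fun i => cell (y i)) m3
  simp only [one_smul] at h2
  rw [hN, ← h2]

/-! ### Random measures and finite partitions. -/

/-- Every event about a measure is an event about its family of evaluations, so laws can be compared
in a product space. -/
theorem measure_measurableSpace_le_comap {X : Type*} [MeasurableSpace X] :
    (Measure.instMeasurableSpace : MeasurableSpace (Measure X)) ≤
      MeasurableSpace.comap (fun (m : Measure X) (s : {s : Set X // MeasurableSet s}) => m s)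
        inferInstance := by
  refine iSup₂_le fun s hs => ?_
  rintro _ ⟨t, ht, rfl⟩
  exact ⟨(fun f => f ⟨s, hs⟩) ⁻¹' t, measurable_pi_apply _ ht, rfl⟩

theorem measurable_eval_subtype {X : Type*} [MeasurableSpace X] :
    Measurable (fun (m : Measure X) (s : {s : Set X // MeasurableSet s}) => m s) :=
  measurable_pi_iff.2 fun s => Measure.measurable_coe s.2

/-- The law of a random finite measure is determined by its values on finite partitions. -/
theorem map_eq_of_partition {X Ω Ω' : Type*} [MeasurableSpace X] [MeasurableSpace Ω]
    [MeasurableSpace Ω'] {μ : Measure Ω} {μ' : Measure Ω'} [IsFiniteMeasure μ]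
    [IsFiniteMeasure μ'] {ξ : Ω → Measure X} {ξ' : Ω' → Measure X} (hξ : Measurable ξ)
    (hξ' : Measurable ξ') (hfin : ∀ ω, IsFiniteMeasure (ξ ω)) (hfin' : ∀ ω, IsFiniteMeasure (ξ' ω))
    (h : ∀ (k : ℕ) (B : Fin k → Set X), (∀ i, MeasurableSet (B i)) →
      Pairwise (fun i j => Disjoint (B i) (B j)) → (⋃ i, B i) = Set.univ →
      μ.map (fun ω i => (ξ ω).real (B i)) = μ'.map (fun ω i => (ξ' ω).real (B i))) :
    μ.map ξ = μ'.map ξ' := by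
  classical
  set Φ := fun (m : Measure X) (s : {s : Set X // MeasurableSet s}) => m s with hΦ
  have hΦm : Measurable Φ := measurable_eval_subtype
  suffices hs : (μ.map ξ).map Φ = (μ'.map ξ').map Φ by
    ext A hA
    obtain ⟨C, hC, rfl⟩ := measure_measurableSpace_le_comap A hA
    rw [← Measure.map_apply hΦm hC, ← Measure.map_apply hΦm hC, hs]
  have key : ∀ I : Finset {s : Set X // MeasurableSet s},
      ((μ.map ξ).map Φ).map I.restrict = ((μ'.map ξ').map Φ).map I.restrict := by
    intro I
    let e := Fintype.equivFin (I → Bool)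
    -- The atoms of the algebra generated by the sets in `I`, indexed by membership patterns; some
    -- may be empty. The map `g` below recovers the mass of a set as the sum over its atoms.
    let B : Fin (Fintype.card (I → Bool)) → Set X :=
      fun i => {x | ∀ s : I, x ∈ s.1.1 ↔ e.symm i s = true}
    have hBm : ∀ i, MeasurableSet (B i) := by
      intro i
      simp only [B, Set.ofPred_forall]
      refine MeasurableSet.iInter fun s => ?_
      have : MeasurableSet (s.1.1) := s.1.2
      by_cases hb : e.symm i s = true
      · convert this using 1
        ext x
        simp [hb]
      · convert this.compl using 1
        ext x
        simp [hb]
    have hBd : Pairwise fun i j => Disjoint (B i) (B j) := by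
      intro i j hij
      rw [Set.disjoint_left]
      intro x hxi hxj
      refine hij (e.symm.injective (funext fun s => ?_))
      exact Bool.eq_iff_iff.2 ((hxi s).symm.trans (hxj s))
    have hBu : (⋃ i, B i) = Set.univ := by
      refine Set.eq_univ_of_forall fun x => Set.mem_iUnion.2 ⟨e fun s => decide (x ∈ s.1.1), ?_⟩
      intro s
      simp
    let g : (Fin (Fintype.card (I → Bool)) → ℝ) → I → ℝ≥0∞ :=
      fun r s => ENNReal.ofReal (∑ i, if e.symm i s = true then r i else 0)
    have hg : Measurable g := by
      refine measurable_pi_iff.2 fun s => ENNReal.measurable_ofReal.comp ?_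
      refine Finset.measurable_sum _ fun i _ => ?_
      split_ifs <;> fun_prop
    have hgm : ∀ m : Measure X, IsFiniteMeasure m →
        I.restrict (Φ m) = g fun i => m.real (B i) := by
      intro m hm
      ext s
      have hs : (s.1.1 : Set X) = ⋃ i ∈ Finset.univ.filter (fun i => e.symm i s = true), B i := by
        ext x
        simp only [Finset.mem_filter, Finset.mem_univ, true_and, Set.mem_iUnion, exists_prop]
        constructor
        · intro hx
          have : x ∈ ⋃ i, B i := by rw [hBu]; trivial
          obtain ⟨i, hi⟩ := Set.mem_iUnion.1 this
          exact ⟨i, (hi s).1 hx, hi⟩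
        · rintro ⟨i, hi, hx⟩
          exact (hx s).2 hi
      have hr : m.real s.1.1 = ∑ i, if e.symm i s = true then m.real (B i) else 0 := by
        rw [hs, measureReal_biUnion_finset (fun i _ j _ hij => hBd hij) (fun i _ => hBm i),
          Finset.sum_filter]
      simp only [g, Finset.restrict, hΦ]
      rw [← hr, ofReal_measureReal]
    have hb : Measurable fun (m : Measure X) i => m.real (B i) := measurable_pi_iff.2 fun i =>
      (Measure.measurable_coe (hBm i)).ennreal_toReal
    have hb1 : Measurable fun ω i => (ξ ω).real (B i) := hb.comp hξ
    have hb2 : Measurable fun ω i => (ξ' ω).real (B i) := hb.comp hξ'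
    have hres : Measurable (I.restrict : ({s : Set X // MeasurableSet s} → ℝ≥0∞) → I → ℝ≥0∞) :=
      Finset.measurable_restrict I
    rw [Measure.map_map hres hΦm, Measure.map_map hres hΦm, Measure.map_map (hres.comp hΦm) hξ,
      Measure.map_map (hres.comp hΦm) hξ']
    have e1 : (I.restrict ∘ Φ) ∘ ξ = g ∘ fun ω i => (ξ ω).real (B i) :=
      funext fun ω => hgm _ (hfin ω)
    have e2 : (I.restrict ∘ Φ) ∘ ξ' = g ∘ fun ω i => (ξ' ω).real (B i) :=
      funext fun ω => hgm _ (hfin' ω)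
    rw [e1, e2, ← Measure.map_map hg hb1, ← Measure.map_map hg hb2,
      h _ B hBm hBd hBu]
  -- Both laws have the same finite-dimensional marginals, and a projective limit of finite measures
  -- is unique.
  have hP : IsProjectiveLimit ((μ'.map ξ').map Φ)
      (fun I => ((μ'.map ξ').map Φ).map I.restrict) := fun I => rfl
  have hP' : IsProjectiveLimit ((μ.map ξ).map Φ)
      (fun I => ((μ'.map ξ').map Φ).map I.restrict) := fun I => key I
  exact hP'.unique hP

/-- With a label for each point, the cell masses of `δ_x` form the basis vector of index `cell x`,
and functions of labels are measurable for free. -/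
theorem exists_cell {X : Type*} [MeasurableSpace X] {k : ℕ} {B : Fin k → Set X}
    (hB : ∀ i, MeasurableSet (B i)) (hd : Pairwise fun i j => Disjoint (B i) (B j))
    (hu : (⋃ i, B i) = Set.univ) :
    ∃ cell : X → Fin k, Measurable cell ∧ ∀ x i, x ∈ B i ↔ cell x = i := by
  have hex : ∀ x, ∃ i, x ∈ B i := fun x => Set.mem_iUnion.1 (hu ▸ Set.mem_univ x)
  choose cell hcell using hex
  have hiff : ∀ x i, x ∈ B i ↔ cell x = i := by
    refine fun x i => ⟨fun hx => ?_, fun h => h ▸ hcell x⟩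
    by_contra hne
    exact Set.disjoint_left.1 (hd hne) (hcell x) hx
  refine ⟨cell, measurable_to_countable' fun i => ?_, hiff⟩
  have : cell ⁻¹' {i} = B i := by ext x; simp [hiff]
  rw [this]
  exact hB i

theorem measurable_mixture {X Ω : Type*} [MeasurableSpace X] [MeasurableSpace Ω] {n : ℕ}
    {θ : Ω → ℝ} {q : Ω → Fin n → ℝ} {y : Ω → Fin n → X} {P : Ω → ProbabilityMeasure X}
    (hθ : Measurable θ) (hq : Measurable q) (hy : Measurable y) (hP : Measurable P) :
    Measurable fun ω => mixture (θ ω) (q ω) (y ω) (P ω) := by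
  refine Measure.measurable_of_measurable_coe _ fun s hs => ?_
  have h1 : ∀ i, Measurable fun ω => Measure.dirac (y ω i) s := fun i =>
    (Measure.measurable_coe hs).comp (Measure.measurable_dirac.comp
      ((measurable_pi_apply i).comp hy))
  have h2 : Measurable fun ω => (P ω : Measure X) s :=
    (Measure.measurable_coe hs).comp (measurable_subtype_coe.comp hP)
  have h3 : ∀ i, Measurable fun ω => q ω i := fun i => (measurable_pi_apply i).comp hq
  simp only [mixture, Measure.add_apply, Measure.smul_apply, Measure.finsetSum_apply, smul_eq_mul]
  fun_prop

/-- Finiteness is needed at every sample point, whereas `0 ≤ t ≤ 1` and `∑ w = 1` hold only almost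
surely; hence no condition on `t` and `w`. -/
theorem isFiniteMeasure_mixture {X : Type*} [MeasurableSpace X] {n : ℕ} (t : ℝ) (w : Fin n → ℝ)
    (y : Fin n → X) (p : ProbabilityMeasure X) : IsFiniteMeasure (mixture t w y p) := by
  refine ⟨?_⟩
  simp only [mixture, Measure.add_apply, Measure.smul_apply, Measure.finsetSum_apply,
    smul_eq_mul, measure_univ, mul_one]
  refine ENNReal.add_lt_top.2 ⟨ENNReal.mul_lt_top ENNReal.ofReal_lt_top ?_, ENNReal.ofReal_lt_top⟩
  exact ENNReal.sum_lt_top.2 fun i _ => ENNReal.ofReal_lt_top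

/-- This turns the equation for measures into the equation for vectors. The sign conditions keep
`ENNReal.ofReal` from truncating. -/
theorem mixture_real {X : Type*} [MeasurableSpace X] {n k : ℕ} {B : Fin k → Set X}
    (hB : ∀ i, MeasurableSet (B i)) {cell : X → Fin k} (hcell : ∀ x i, x ∈ B i ↔ cell x = i)
    {t : ℝ} (ht0 : 0 ≤ t) (ht1 : t ≤ 1) {w : Fin n → ℝ} (hw : ∀ i, 0 ≤ w i) (y : Fin n → X)
    (p : ProbabilityMeasure X) :
    (fun j => (mixture t w y p).real (B j)) =
      t • ∑ i, w i • (Pi.single (cell (y i)) 1 : Fin k → ℝ) +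
        (1 - t) • fun j => (p : Measure X).real (B j) := by
  ext j
  have h1 : (1 : ℝ) - t ≥ 0 := by linarith
  simp only [measureReal_def, mixture, Measure.add_apply, Measure.smul_apply,
    Measure.finsetSum_apply, smul_eq_mul, Pi.add_apply, Pi.smul_apply, Finset.sum_apply]
  have hs : ∀ i, ENNReal.ofReal (w i) * Measure.dirac (y i) (B j) =
      ENNReal.ofReal (w i * (Pi.single (cell (y i)) 1 : Fin k → ℝ) j) := by
    intro i
    rw [Measure.dirac_apply' _ (hB j)]
    by_cases h : cell (y i) = j
    · simp [(hcell _ _).2 h, h]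
    · rw [Set.indicator_of_notMem (fun h' => h ((hcell _ _).1 h')),
        Pi.single_eq_of_ne (Ne.symm h)]
      simp
  simp_rw [hs]
  have hnn : ∀ i ∈ Finset.univ, 0 ≤ w i * (Pi.single (cell (y i)) 1 : Fin k → ℝ) j := by
    intro i _
    refine mul_nonneg (hw i) ?_
    rw [Pi.single_apply]
    split_ifs <;> simp
  rw [← ENNReal.ofReal_sum_of_nonneg hnn, ENNReal.toReal_add
    (ENNReal.mul_ne_top ENNReal.ofReal_ne_top ENNReal.ofReal_ne_top)
    (ENNReal.mul_ne_top ENNReal.ofReal_ne_top (measure_ne_top _ _)), ENNReal.toReal_mul,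
    ENNReal.toReal_mul, ENNReal.toReal_ofReal ht0, ENNReal.toReal_ofReal h1,
    ENNReal.toReal_ofReal (Finset.sum_nonneg hnn)]

/-! ### Pólya sequences and averaged Dirichlet updates. -/

/-- The restriction of `μ` to `E` and the measure with density `pr` agree on `m`, by the defining
property of conditional expectation; so they integrate `m`-measurable functions alike, without
integrability of `H`. -/
theorem lintegral_mul_indicator_of_condExp {Ω : Type*} {m m0 : MeasurableSpace Ω} {μ : Measure Ω}
    [IsFiniteMeasure μ] (hm : m ≤ m0) {E : Set Ω} (hE : MeasurableSet E) {pr : Ω → ℝ}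
    (hprm : Measurable pr) (hpr0 : ∀ ω, 0 ≤ pr ω)
    (hprd : μ[E.indicator (fun _ => (1 : ℝ)) | m] =ᵐ[μ] pr) {H : Ω → ℝ≥0∞}
    (hH : Measurable[m] H) :
    ∫⁻ ω, H ω * E.indicator 1 ω ∂μ = ∫⁻ ω, H ω * ENNReal.ofReal (pr ω) ∂μ := by
  have hpri : Integrable pr μ := integrable_condExp.congr hprd
  have hmeas : (μ.restrict E).trim hm = (μ.withDensity fun ω => ENNReal.ofReal (pr ω)).trim hm := by
    refine @Measure.ext _ m _ _ fun T hT => ?_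
    rw [trim_measurableSet_eq hm hT, trim_measurableSet_eq hm hT,
      Measure.restrict_apply (hm T hT), withDensity_apply _ (hm T hT),
      ← ofReal_integral_eq_lintegral_ofReal hpri.integrableOn (ae_of_all _ hpr0),
      ← setIntegral_congr_ae (hm T hT) (hprd.mono fun ω h _ => h),
      setIntegral_condExp hm ((integrable_const 1).indicator hE) hT,
      setIntegral_indicator hE, setIntegral_const, smul_eq_mul, mul_one, ofReal_measureReal]
  have e1 : ∫⁻ ω, H ω * E.indicator 1 ω ∂μ = ∫⁻ ω, H ω ∂μ.restrict E := by
    rw [← lintegral_indicator hE]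
    refine lintegral_congr fun ω => ?_
    by_cases h : ω ∈ E <;> simp [h]
  rw [e1, ← lintegral_trim hm hH, hmeas, lintegral_trim hm hH,
    lintegral_withDensity_eq_lintegral_mul _ hprm.ennreal_ofReal (hH.mono hm le_rfl)]
  refine lintegral_congr fun ω => ?_
  rw [Pi.mul_apply, mul_comm]

/-- The predictive probabilities of a Pólya sequence in integrated form. -/
theorem IsPolyaSequence.lintegral_predictive {X Ω : Type*} [MeasurableSpace X] [MeasurableSpace Ω]
    {α : Measure X} [IsFiniteMeasure α] {μ : Measure Ω} [IsProbabilityMeasure μ]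
    {Y : ℕ → Ω → X} (hY : IsPolyaSequence α μ Y) (j : ℕ) {A : Set X} (hA : MeasurableSet A)
    {H : (Fin j → X) → ℝ≥0∞} (hH : Measurable H) :
    ∫⁻ ω, H (fun i => Y i ω) * (Y j ⁻¹' A).indicator 1 ω ∂μ =
      ∫⁻ ω, H (fun i => Y i ω) * ENNReal.ofReal ((α.real A +
        ∑ i : Fin j, (Measure.dirac (Y i ω)).real A) / (α.real Set.univ + j)) ∂μ := by
  have hE : MeasurableSet (Y j ⁻¹' A) := hY.measurable j hA
  obtain _ | j := j
  -- With no past, `H` is a constant and the formula is the law of `Y 0`.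
  · have hc : ∀ ω, H (fun i => Y i ω) = H (fun i => i.elim0) := fun ω =>
      congrArg H (Subsingleton.elim _ _)
    simp only [hc, Finset.univ_eq_empty, Finset.sum_empty, CharP.cast_eq_zero, add_zero]
    rw [lintegral_const_mul _ (measurable_one.indicator hE), lintegral_indicator_one hE,
      lintegral_const, measure_univ, mul_one]
    congr 1
    have := congrArg (fun m => m A) hY.hasLaw_zero.map_eq
    simp only [Measure.map_apply (hY.measurable 0) hA, Measure.smul_apply, smul_eq_mul] at this
    rw [this]
    have hne : α Set.univ ≠ 0 := by
      intro h0
      have h1 := congrArg (fun m => m Set.univ) hY.hasLaw_zero.map_eq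
      simp [Measure.map_apply (hY.measurable 0) MeasurableSet.univ, h0] at h1
    rw [measureReal_def, measureReal_def, ENNReal.ofReal_div_of_pos
      (ENNReal.toReal_pos hne (measure_ne_top _ _)), ENNReal.ofReal_toReal (measure_ne_top _ _),
      ENNReal.ofReal_toReal (measure_ne_top _ _), ENNReal.div_eq_inv_mul]
  · set Z : Ω → Fin (j + 1) → X := fun ω i => Y i ω with hZ
    have hZm : Measurable Z := measurable_pi_iff.2 fun i => hY.measurable i
    refine lintegral_mul_indicator_of_condExp hZm.comap_le hE ?_ (fun ω => by positivity)
      (hY.predictive (j + 1) (by omega) A hA) (hH.comp (comap_measurable Z))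
    have : ∀ i : Fin (j + 1), Measurable fun ω => (Measure.dirac (Y i ω)).real A := fun i =>
      ((Measure.measurable_coe hA).comp
        (Measure.measurable_dirac.comp (hY.measurable i))).ennreal_toReal
    fun_prop

/-- Averaging the updates of a Dirichlet distribution by the first terms of a Pólya sequence gives
back the Dirichlet distribution. -/
theorem IsPolyaSequence.lintegral_dirichletMeasure_update {X Ω : Type*} [MeasurableSpace X]
    [MeasurableSpace Ω] {α : Measure X} [IsFiniteMeasure α] (hα : α ≠ 0) {μ : Measure Ω}
    [IsProbabilityMeasure μ] {Y : ℕ → Ω → X} (hY : IsPolyaSequence α μ Y) {k : ℕ}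
    {B : Fin k → Set X} (hB : ∀ i, MeasurableSet (B i)) {cell : X → Fin k}
    (hcm : Measurable cell) (hcell : ∀ x i, x ∈ B i ↔ cell x = i)
    (hs : ∑ i, α.real (B i) = α.real Set.univ) {f : (Fin k → ℝ) → ℝ≥0∞} (hf : Measurable f)
    (n : ℕ) :
    ∫⁻ ω, ∫⁻ v, f v ∂dirichletMeasure
        ((fun i => α.real (B i)) + ∑ i : Fin n, Pi.single (cell (Y i ω)) 1) ∂μ =
      ∫⁻ v, f v ∂dirichletMeasure (fun i => α.real (B i)) := by
  set c : Fin k → ℝ := fun i => α.real (B i) with hc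
  have ha : 0 < α.real Set.univ := by
    rw [measureReal_def]
    exact ENNReal.toReal_pos (Measure.measure_univ_ne_zero.2 hα) (measure_ne_top _ _)
  induction n with
  | zero => simp
  | succ n ih =>
    rw [← ih]
    -- The integral for past labels `d` and next label `l`. Its dependence on the points is only
    -- through finitely many labels, which settles measurability.
    let G : (Fin n → Fin k) → Fin k → ℝ≥0∞ := fun d l =>
      ∫⁻ v, f v ∂dirichletMeasure (c + ∑ i, Pi.single (d i) 1 + Pi.single l 1)
    have hcells : Measurable fun y : Fin n → X => fun i => cell (y i) :=
      measurable_pi_iff.2 fun i => hcm.comp (measurable_pi_apply i)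
    have hGm : ∀ l, Measurable fun y : Fin n → X => G (fun i => cell (y i)) l := fun l =>
      (Measurable.of_discrete (f := fun d => G d l)).comp hcells
    have hZm : Measurable fun ω => fun i : Fin n => Y i ω :=
      measurable_pi_iff.2 fun i => hY.measurable i
    have e1 : ∀ ω, ∫⁻ v, f v ∂dirichletMeasure
        (c + ∑ i : Fin (n + 1), Pi.single (cell (Y i ω)) 1) =
        ∑ l, G (fun i => cell (Y i ω)) l * (Y n ⁻¹' B l).indicator 1 ω := by
      intro ω
      rw [Finset.sum_eq_single (cell (Y n ω))]
      · have : ω ∈ Y n ⁻¹' B (cell (Y n ω)) := (hcell _ _).2 rfl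
        rw [Set.indicator_of_mem this, Pi.one_apply, mul_one, Fin.sum_univ_castSucc, ← add_assoc]
        rfl
      · intro l _ hl
        have : ω ∉ Y n ⁻¹' B l := fun h => hl ((hcell _ _).1 h).symm
        rw [Set.indicator_of_notMem this, mul_zero]
      · simp
    have hdir : ∀ x l, (Measure.dirac x).real (B l) = (Pi.single (cell x) 1 : Fin k → ℝ) l := by
      intro x l
      rw [measureReal_def, Measure.dirac_apply' _ (hB l)]
      by_cases h : cell x = l
      · simp [(hcell _ _).2 h, h]
      · rw [Set.indicator_of_notMem (fun h' => h ((hcell _ _).1 h')),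
          Pi.single_eq_of_ne (Ne.symm h)]
        simp
    have hGZ : ∀ l, Measurable fun ω => G (fun i => cell (Y i ω)) l := fun l => (hGm l).comp hZm
    rw [lintegral_congr e1, lintegral_finsetSum _ fun l _ =>
      (hGZ l).fun_mul (measurable_one.indicator (hY.measurable n (hB l)))]
    rw [Finset.sum_congr rfl fun l _ => hY.lintegral_predictive n (hB l) (hGm l)]
    have hprm : ∀ l, Measurable fun ω => (α.real (B l) +
        ∑ i : Fin n, (Measure.dirac (Y i ω)).real (B l)) / (α.real Set.univ + n) := by
      intro l
      have : ∀ i : Fin n, Measurable fun ω => (Measure.dirac (Y i ω)).real (B l) := fun i =>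
        ((Measure.measurable_coe (hB l)).comp
          (Measure.measurable_dirac.comp (hY.measurable i))).ennreal_toReal
      fun_prop
    rw [← lintegral_finsetSum _ fun l _ =>
      (hGZ l).fun_mul (hprm l).ennreal_ofReal]
    refine lintegral_congr fun ω => ?_
    set c' : Fin k → ℝ := c + ∑ i : Fin n, Pi.single (cell (Y i ω)) 1 with hc'
    have hc'0 : ∀ l, 0 ≤ c' l := by
      intro l
      simp only [hc', Pi.add_apply, Finset.sum_apply, ← hdir, hc]
      positivity
    have hc's : ∑ l, c' l = α.real Set.univ + n := by
      simp only [hc', Pi.add_apply, Finset.sum_add_distrib, Finset.sum_apply]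
      rw [Finset.sum_comm, hs]
      simp
    -- The predictive probability of cell `l` is `c' l / ∑ c'`, exactly the weight of the update by
    -- `e_l` in the mixture representation of `Dirichlet(c')`.
    rw [← sum_lintegral_dirichletMeasure_add_single hc'0 (by rw [hc's]; positivity) hf]
    refine Finset.sum_congr rfl fun l _ => ?_
    rw [mul_comm, hc's]
    congr 3
    simp only [hc', Pi.add_apply, Finset.sum_apply, hdir, hc]

/-- The vector of the masses that a probability measure gives to the cells of a partition. -/
noncomputable def cellMass {X : Type*} [MeasurableSpace X] {k : ℕ} (B : Fin k → Set X)
    (p : ProbabilityMeasure X) : Fin k → ℝ := fun i => (p : Measure X).real (B i)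

theorem measurable_cellMass {X : Type*} [MeasurableSpace X] {k : ℕ} {B : Fin k → Set X}
    (hB : ∀ i, MeasurableSet (B i)) : Measurable (cellMass B) :=
  measurable_pi_iff.2 fun i =>
    ((Measure.measurable_coe (hB i)).comp measurable_subtype_coe).ennreal_toReal

theorem sum_measureReal_partition {X : Type*} [MeasurableSpace X] (m : Measure X)
    [IsFiniteMeasure m] {k : ℕ} {B : Fin k → Set X} (hB : ∀ i, MeasurableSet (B i))
    (hd : Pairwise fun i j => Disjoint (B i) (B j)) (hu : (⋃ i, B i) = Set.univ) :
    ∑ i, m.real (B i) = m.real Set.univ := by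
  rw [← hu, measureReal_iUnion_fintype hd hB]

theorem norm_cellMass_le_one {X : Type*} [MeasurableSpace X] {k : ℕ} {B : Fin k → Set X}
    (hB : ∀ i, MeasurableSet (B i)) (hd : Pairwise fun i j => Disjoint (B i) (B j))
    (hu : (⋃ i, B i) = Set.univ) (p : ProbabilityMeasure X) : ‖cellMass B p‖ ≤ 1 := by
  refine norm_le_one_of_sum_eq_one (fun i => measureReal_nonneg) ?_
  have := sum_measureReal_partition (p : Measure X) hB hd hu
  rw [probReal_univ] at this
  exact this

theorem measureReal_univ_pos {X : Type*} [MeasurableSpace X] {α : Measure X} [IsFiniteMeasure α]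
    (hα : α ≠ 0) : 0 < α.real Set.univ :=
  ENNReal.toReal_pos (Measure.measure_univ_ne_zero.2 hα) (measure_ne_top _ _)

/-- The random vector `∑ i, q i δ_{y i}`, evaluated on the cells of a partition. -/
noncomputable def cellWeights {X : Type*} {n k : ℕ} (cell : X → Fin k)
    (e : ℝ × (Fin n → ℝ) × (Fin n → X)) : Fin k → ℝ :=
  ∑ i, e.2.1 i • Pi.single (cell (e.2.2 i)) 1

theorem measurable_cellWeights {X : Type*} [MeasurableSpace X] {n k : ℕ} {cell : X → Fin k}
    (hcell : Measurable cell) :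
    Measurable (cellWeights cell : ℝ × (Fin n → ℝ) × (Fin n → X) → Fin k → ℝ) := by
  have hsingle : Measurable fun j : Fin k => (Pi.single j 1 : Fin k → ℝ) := Measurable.of_discrete
  refine Finset.measurable_sum _ fun i _ => Measurable.smul
    ((measurable_pi_apply i).comp (measurable_fst.comp measurable_snd)) ?_
  exact hsingle.comp (hcell.comp ((measurable_pi_apply i).comp
    (measurable_snd.comp measurable_snd)))

theorem IsPolyaSequence.dirichletMeasure_eq_mixtureLaw {X Ω : Type*} [MeasurableSpace X]
    [MeasurableSpace Ω] {α : Measure X} [IsFiniteMeasure α] (hα : α ≠ 0) {μ : Measure Ω}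
    [IsProbabilityMeasure μ] {Y : ℕ → Ω → X} (hY : IsPolyaSequence α μ Y) {n k : ℕ} (hn : 1 ≤ n)
    {B : Fin k → Set X} (hB : ∀ i, MeasurableSet (B i))
    (hd : Pairwise fun i j => Disjoint (B i) (B j)) (hu : (⋃ i, B i) = Set.univ)
    {cell : X → Fin k} (hcm : Measurable cell) (hcell : ∀ x i, x ∈ B i ↔ cell x = i) :
    dirichletMeasure (fun i => α.real (B i)) =
      mixtureLaw (mixtureParamLaw (α.real Set.univ) (μ.map fun ω (i : Fin n) => Y i ω))
        (fun e => e.1) (cellWeights cell) (dirichletMeasure fun i => α.real (B i)) := by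
  have hZm : Measurable fun ω => fun i : Fin n => Y i ω :=
    measurable_pi_iff.2 fun i => hY.measurable i
  have hs := sum_measureReal_partition α hB hd hu
  have hρ : IsProbabilityMeasure (μ.map fun ω (i : Fin n) => Y i ω) :=
    Measure.isProbabilityMeasure_map hZm.aemeasurable
  have h := _root_.dirichletMeasure_eq_mixtureLaw (c := fun i => α.real (B i)) (n := n) hn
    (fun i => measureReal_nonneg) (by rw [hs]; exact measureReal_univ_pos hα)
    (ρ := μ.map fun ω (i : Fin n) => Y i ω) hcm (fun f hf => by
      have hcells : Measurable fun y : Fin n → X => fun i => cell (y i) :=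
        measurable_pi_iff.2 fun i => hcm.comp (measurable_pi_apply i)
      have hG : Measurable fun y : Fin n → X => ∫⁻ v, f v ∂dirichletMeasure
          ((fun i => α.real (B i)) + ∑ i : Fin n, (Pi.single (cell (y i)) 1 : Fin k → ℝ)) :=
        (Measurable.of_discrete (f := fun d : Fin n → Fin k => ∫⁻ v, f v ∂dirichletMeasure
          ((fun i => α.real (B i)) + ∑ i : Fin n, (Pi.single (d i) 1 : Fin k → ℝ)))).comp hcells
      rw [lintegral_map hG hZm]
      exact hY.lintegral_dirichletMeasure_update hα hB hcm hcell hs hf n)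
  rw [hs] at h
  exact h

theorem isProbabilityMeasure_mixtureParamLaw {X : Type*} [MeasurableSpace X] {n : ℕ} (hn : 1 ≤ n)
    {a : ℝ} (ha : 0 < a) (ρ : Measure (Fin n → X)) [IsProbabilityMeasure ρ] :
    IsProbabilityMeasure (mixtureParamLaw a ρ) := by
  have := isProbabilityMeasureBeta (show (0 : ℝ) < n by exact_mod_cast hn) ha
  unfold mixtureParamLaw
  infer_instance

theorem ae_mixtureParamLaw {X : Type*} [MeasurableSpace X] {n : ℕ} (hn : 1 ≤ n)
    (a : ℝ) (ρ : Measure (Fin n → X)) [IsProbabilityMeasure ρ] :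
    ∀ᵐ e ∂mixtureParamLaw a ρ, (0 < e.1 ∧ e.1 < 1) ∧ (∀ i, 0 ≤ e.2.1 i) ∧ ∑ i, e.2.1 i = 1 := by
  have h1 : ∀ᵐ e ∂mixtureParamLaw a ρ, 0 < e.1 ∧ e.1 < 1 :=
    Measure.quasiMeasurePreserving_fst.ae (ae_betaMeasure n a)
  have h2 : ∀ᵐ e ∂mixtureParamLaw a ρ, (∀ i, 0 ≤ e.2.1 i) ∧ ∑ i, e.2.1 i = 1 :=
    Measure.quasiMeasurePreserving_snd.ae (Measure.quasiMeasurePreserving_fst.ae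
      ((ae_dirichletMeasure_nonneg fun _ => zero_le_one).and
        (ae_sum_dirichletMeasure (fun _ => zero_le_one)
          (by simpa using Nat.lt_of_lt_of_le Nat.zero_lt_one hn))))
  filter_upwards [h1, h2] with e he1 he2 using ⟨he1, he2⟩

/-! ### The stick-breaking construction. -/

/-- Prepending an independent term of law `ν` to an i.i.d. sequence gives an i.i.d. sequence, as
seen on cylinders; splitting off the head undoes the prepending. -/
theorem map_head_tail_infinitePi {E : Type*} [MeasurableSpace E] (ν : Measure E)
    [IsProbabilityMeasure ν] :
    (Measure.infinitePi fun _ : ℕ => ν).map (fun ω => (ω 0, fun m => ω (m + 1))) =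
      ν.prod (Measure.infinitePi fun _ : ℕ => ν) := by
  let g : E × (ℕ → E) → ℕ → E := fun p m => Nat.casesOn m p.1 p.2
  have hg : Measurable g := by
    refine measurable_pi_iff.2 fun m => ?_
    cases m with
    | zero => exact measurable_fst
    | succ m => exact (measurable_pi_apply m).comp measurable_snd
  have h : (ν.prod (Measure.infinitePi fun _ : ℕ => ν)).map g =
      Measure.infinitePi fun _ : ℕ => ν := by
    refine Measure.eq_infinitePi _ fun s t ht => ?_
    classical
    -- Padding by the whole space puts the cylinder on an initial segment, where head and tail
    -- separate.
    let t' : ℕ → Set E := fun i => if i ∈ s then t i else Set.univ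
    have ht' : ∀ i, MeasurableSet (t' i) := fun i => by
      simp only [t']; split_ifs; exacts [ht i, MeasurableSet.univ]
    obtain ⟨N, hN⟩ : ∃ N, s ⊆ Finset.range (N + 1) :=
      ⟨s.sup id, fun i hi => Finset.mem_range.2 (Nat.lt_succ_of_le (Finset.le_sup (f := id) hi))⟩
    have e1 : Set.pi (s : Set ℕ) t = Set.pi (Finset.range (N + 1) : Set ℕ) t' := by
      ext x
      simp only [Set.mem_pi, Finset.mem_coe, t']
      refine ⟨fun hx i _ => ?_, fun hx i hi => by simpa [hi] using hx i (hN hi)⟩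
      split_ifs with hi
      · exact hx i hi
      · trivial
    have e2 : ∏ i ∈ s, ν (t i) = ∏ i ∈ Finset.range (N + 1), ν (t' i) := by
      rw [← Finset.prod_subset hN (fun i _ hi => by simp [t', hi])]
      exact Finset.prod_congr rfl fun i hi => by simp [t', hi]
    have e3 : g ⁻¹' Set.pi (Finset.range (N + 1) : Set ℕ) t' =
        t' 0 ×ˢ Set.pi (Finset.range N : Set ℕ) fun i => t' (i + 1) := by
      ext p
      simp only [Set.mem_preimage, Set.mem_pi, Finset.mem_coe, Finset.mem_range, Set.mem_prod]
      refine ⟨fun hp => ⟨hp 0 (by omega), fun i hi => hp (i + 1) (by omega)⟩, fun hp i hi => ?_⟩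
      cases i with
      | zero => exact hp.1
      | succ i => exact hp.2 i (by omega)
    rw [e1, e2, Measure.map_apply hg (MeasurableSet.pi (Finset.countable_toSet _)
      fun i _ => ht' i), e3, Measure.prod_prod, Measure.infinitePi_pi _ (fun i _ => ht' (i + 1)),
      Finset.prod_range_succ' , mul_comm]
  have hf : Measurable fun ω : ℕ → E => (ω 0, fun m => ω (m + 1)) :=
    (measurable_pi_apply 0).prodMk (measurable_pi_iff.2 fun m => measurable_pi_apply (m + 1))
  conv_lhs => rw [← h]
  rw [Measure.map_map hf hg]
  have : (fun ω : ℕ → E => (ω 0, fun m => ω (m + 1))) ∘ g = id := rfl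
  rw [this, Measure.map_id]

/-- The stick-breaking measure `∑ m, θ m ∏_{l < m} (1 - θ l) ∑ i, q m i δ_{y m i}`. -/
noncomputable def stickBreaking {X : Type*} [MeasurableSpace X] {n : ℕ}
    (ω : ℕ → ℝ × (Fin n → ℝ) × (Fin n → X)) : Measure X :=
  Measure.sum fun m => ((∏ l ∈ Finset.range m, ENNReal.ofReal (1 - (ω l).1)) *
    ENNReal.ofReal (ω m).1) • ∑ i, ENNReal.ofReal ((ω m).2.1 i) • Measure.dirac ((ω m).2.2 i)

/-- Every term after the first carries the factor `1 - θ 0`. This is the distributional equation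
holding pathwise, with the shifted sequence driving the copy of `P` on the right. -/
theorem stickBreaking_eq {X : Type*} [MeasurableSpace X] {n : ℕ}
    (ω : ℕ → ℝ × (Fin n → ℝ) × (Fin n → X)) :
    stickBreaking ω = ENNReal.ofReal (ω 0).1 •
        ∑ i, ENNReal.ofReal ((ω 0).2.1 i) • Measure.dirac ((ω 0).2.2 i) +
      ENNReal.ofReal (1 - (ω 0).1) • stickBreaking fun m => ω (m + 1) := by
  ext s hs
  rw [stickBreaking, Measure.sum_apply _ hs, tsum_eq_zero_add' ENNReal.summable,
    Measure.add_apply]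
  simp only [Finset.range_zero, Finset.prod_empty, one_mul, smul_eq_mul, Measure.smul_apply,
    stickBreaking, Measure.sum_apply _ hs]
  rw [← ENNReal.tsum_mul_left]
  congr 1
  refine tsum_congr fun m => ?_
  rw [Finset.prod_range_succ']
  ring

theorem measurable_stickBreaking {X : Type*} [MeasurableSpace X] {n : ℕ} :
    Measurable (stickBreaking : (ℕ → ℝ × (Fin n → ℝ) × (Fin n → X)) → Measure X) := by
  refine Measure.measurable_of_measurable_coe _ fun s hs => ?_
  have h1 : ∀ m i, Measurable fun ω : ℕ → ℝ × (Fin n → ℝ) × (Fin n → X) =>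
      Measure.dirac ((ω m).2.2 i) s := fun m i =>
    (Measure.measurable_coe hs).comp (Measure.measurable_dirac.comp (by fun_prop))
  simp only [stickBreaking, Measure.sum_apply _ hs, Measure.smul_apply, Measure.finsetSum_apply,
    smul_eq_mul]
  refine Measurable.tsum fun m => ?_
  fun_prop

theorem stickBreaking_univ_le_one {X : Type*} [MeasurableSpace X] {n : ℕ}
    {ω : ℕ → ℝ × (Fin n → ℝ) × (Fin n → X)}
    (hω : ∀ m, (0 < (ω m).1 ∧ (ω m).1 < 1) ∧ (∀ i, 0 ≤ (ω m).2.1 i) ∧ ∑ i, (ω m).2.1 i = 1) :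
    stickBreaking ω Set.univ ≤ 1 := by
  rw [stickBreaking, Measure.sum_apply _ MeasurableSet.univ]
  refine ENNReal.tsum_le_of_sum_range_le fun N => ?_
  have h1 : ∀ m, ∑ i, ENNReal.ofReal ((ω m).2.1 i) = 1 := fun m => by
    rw [← ENNReal.ofReal_sum_of_nonneg fun i _ => (hω m).2.1 i, (hω m).2.2, ENNReal.ofReal_one]
  simp only [Measure.smul_apply, Measure.finsetSum_apply, measure_univ, smul_eq_mul, mul_one, h1]
  -- The mass broken off in `N` steps and the remaining stick add up to exactly `1`.
  suffices h : ∑ m ∈ Finset.range N, (∏ l ∈ Finset.range m, ENNReal.ofReal (1 - (ω l).1)) *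
      ENNReal.ofReal (ω m).1 + ∏ l ∈ Finset.range N, ENNReal.ofReal (1 - (ω l).1) = 1 by
    rw [← h]; exact le_self_add
  induction N with
  | zero => simp
  | succ N ih =>
    rw [Finset.sum_range_succ, Finset.prod_range_succ, add_assoc, ← mul_add,
      ← ENNReal.ofReal_add (hω N).1.1.le (by linarith [(hω N).1.2])]
    simpa using ih

/-- The expected missing mass `I` is finite and satisfies `I = E(1 - θ) I` by the pathwise recursion
and independence of head and tail; since `E(1 - θ) < 1`, it is zero. -/
theorem ae_stickBreaking_univ {X : Type*} [MeasurableSpace X] {n : ℕ}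
    {ν : Measure (ℝ × (Fin n → ℝ) × (Fin n → X))} [IsProbabilityMeasure ν]
    (hν : ∀ᵐ e ∂ν, (0 < e.1 ∧ e.1 < 1) ∧ (∀ i, 0 ≤ e.2.1 i) ∧ ∑ i, e.2.1 i = 1) :
    ∀ᵐ ω ∂Measure.infinitePi fun _ : ℕ => ν, stickBreaking ω Set.univ = 1 := by
  set Λ := Measure.infinitePi fun _ : ℕ => ν with hΛ
  have hgood : ∀ᵐ ω ∂Λ, ∀ m, (0 < (ω m).1 ∧ (ω m).1 < 1) ∧ (∀ i, 0 ≤ (ω m).2.1 i) ∧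
      ∑ i, (ω m).2.1 i = 1 := ae_all_iff.2 fun m =>
    (measurePreserving_eval_infinitePi (fun _ : ℕ => ν) m).quasiMeasurePreserving.ae hν
  have hmass : Measurable fun ω : ℕ → ℝ × (Fin n → ℝ) × (Fin n → X) =>
      1 - stickBreaking ω Set.univ :=
    measurable_const.sub ((Measure.measurable_coe MeasurableSet.univ).comp measurable_stickBreaking)
  have hf : Measurable fun ω : ℕ → ℝ × (Fin n → ℝ) × (Fin n → X) => (ω 0, fun m => ω (m + 1)) :=
    (measurable_pi_apply 0).prodMk (measurable_pi_iff.2 fun m => measurable_pi_apply (m + 1))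
  set I := ∫⁻ ω, (1 - stickBreaking ω Set.univ) ∂Λ with hI
  have hItop : I ≠ ∞ := by
    refine ne_top_of_le_ne_top ENNReal.one_ne_top ?_
    calc I ≤ ∫⁻ _, 1 ∂Λ := lintegral_mono fun ω => tsub_le_self
      _ = 1 := by simp
  have hrec : I = (∫⁻ e, ENNReal.ofReal (1 - e.1) ∂ν) * I := by
    have e1 : I = ∫⁻ ω, ENNReal.ofReal (1 - (ω 0).1) *
        (1 - stickBreaking (fun m => ω (m + 1)) Set.univ) ∂Λ := by
      refine lintegral_congr_ae ?_
      filter_upwards [hgood] with ω hω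
      have h1 : ∑ i, ENNReal.ofReal ((ω 0).2.1 i) = 1 := by
        rw [← ENNReal.ofReal_sum_of_nonneg fun i _ => (hω 0).2.1 i, (hω 0).2.2, ENNReal.ofReal_one]
      rw [stickBreaking_eq ω]
      simp only [Measure.add_apply, Measure.smul_apply, Measure.finsetSum_apply, measure_univ,
        smul_eq_mul, mul_one, h1]
      rw [tsub_add_eq_tsub_tsub, ← ENNReal.ofReal_one, ← ENNReal.ofReal_sub _ (hω 0).1.1.le,
        ENNReal.ofReal_one, ENNReal.mul_sub (fun _ _ => ENNReal.ofReal_ne_top), mul_one]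
    have e2 := lintegral_map (μ := Λ) (f := fun p : (ℝ × (Fin n → ℝ) × (Fin n → X)) ×
      (ℕ → ℝ × (Fin n → ℝ) × (Fin n → X)) => ENNReal.ofReal (1 - p.1.1) *
        (1 - stickBreaking p.2 Set.univ))
      ((measurable_const.sub (measurable_fst.comp measurable_fst)).ennreal_ofReal.mul
        (hmass.comp measurable_snd)) hf
    have e3 : Λ.map (fun ω => (ω 0, fun m => ω (m + 1))) = ν.prod Λ := map_head_tail_infinitePi ν
    rw [e3] at e2
    refine (e1.trans e2.symm).trans ?_
    exact lintegral_prod_mul (μ := ν) (ν := Λ)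
      (f := fun e => ENNReal.ofReal (1 - e.1)) (g := fun ω => 1 - stickBreaking ω Set.univ)
      (measurable_const.sub measurable_fst).ennreal_ofReal.aemeasurable hmass.aemeasurable
  have hr : ∫⁻ e, ENNReal.ofReal (1 - e.1) ∂ν < 1 := by
    have hnn : ∀ᵐ e ∂ν, 0 ≤ 1 - e.1 := by
      filter_upwards [hν] with e he
      linarith [he.1.2]
    have hi : Integrable (fun e : ℝ × (Fin n → ℝ) × (Fin n → X) => 1 - e.1) ν :=
      Integrable.of_bound (C := 1) (by fun_prop) (by
        filter_upwards [hν] with e he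
        rw [Real.norm_of_nonneg (by linarith [he.1.2])]
        linarith [he.1.1])
    rw [← ofReal_integral_eq_lintegral_ofReal hi hnn]
    exact (ENNReal.ofReal_lt_one).2 (integral_one_sub_lt_one measurable_fst
      (hν.mono fun e he => he.1))
  have hI0 : I = 0 := by
    by_contra hne
    have := ENNReal.mul_lt_mul_left hne hItop hr
    rw [one_mul, ← hrec] at this
    exact lt_irrefl _ this
  have h0 := (lintegral_eq_zero_iff hmass).1 hI0
  filter_upwards [h0, hgood] with ω h hω
  -- Subtraction is truncated, so vanishing missing mass only gives mass at least `1`.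
  exact le_antisymm (stickBreaking_univ_le_one hω) (tsub_eq_zero_iff_le.1 h)

/-- The stick-breaking construction of a random probability measure that solves the distributional
equation. -/
theorem exists_stickBreaking_solution {X : Type*} [MeasurableSpace X] [Nonempty X] {n : ℕ}
    (ν : Measure (ℝ × (Fin n → ℝ) × (Fin n → X))) [IsProbabilityMeasure ν]
    (hν : ∀ᵐ e ∂ν, (0 < e.1 ∧ e.1 < 1) ∧ (∀ i, 0 ≤ e.2.1 i) ∧ ∑ i, e.2.1 i = 1) :
    ∃ D : Measure (ProbabilityMeasure X), IsProbabilityMeasure D ∧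
      ∀ (k : ℕ) (B : Fin k → Set X), (∀ i, MeasurableSet (B i)) →
        ∀ cell : X → Fin k, Measurable cell → (∀ x i, x ∈ B i ↔ cell x = i) →
          D.map (cellMass B) =
            mixtureLaw ν (fun e => e.1) (cellWeights cell) (D.map (cellMass B)) := by
  classical
  obtain ⟨x₀⟩ := ‹Nonempty X›
  set Λ := Measure.infinitePi fun _ : ℕ => ν with hΛ
  let P : (ℕ → ℝ × (Fin n → ℝ) × (Fin n → X)) → ProbabilityMeasure X := fun ω =>
    if h : IsProbabilityMeasure (stickBreaking ω) then ⟨stickBreaking ω, h⟩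
    else ⟨Measure.dirac x₀, inferInstance⟩
  have hPm : Measurable P := by
    refine Measurable.subtype_mk (f := fun ω => (P ω : Measure X)) (h := fun ω => (P ω).2) ?_
    have : (fun ω => (P ω : Measure X)) = fun ω =>
        if stickBreaking ω ∈ {m : Measure X | IsProbabilityMeasure m} then stickBreaking ω
        else Measure.dirac x₀ := by
      ext1 ω
      by_cases h : IsProbabilityMeasure (stickBreaking ω) <;> simp [P, h]
    rw [this]
    exact Measurable.ite (measurable_stickBreaking
      ProbabilityMeasure.measurableSet_isProbabilityMeasure) measurable_stickBreaking
        measurable_const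
  have hf : Measurable fun ω : ℕ → ℝ × (Fin n → ℝ) × (Fin n → X) => (ω 0, fun m => ω (m + 1)) :=
    (measurable_pi_apply 0).prodMk (measurable_pi_iff.2 fun m => measurable_pi_apply (m + 1))
  have hPa : ∀ᵐ ω ∂Λ, (P ω : Measure X) = stickBreaking ω := by
    filter_upwards [ae_stickBreaking_univ hν] with ω hω
    have : IsProbabilityMeasure (stickBreaking ω) := ⟨hω⟩
    simp [P, this]
  -- The shift preserves `Λ`, so the shifted sequence also almost surely avoids the default value
  -- `δ_{x₀}` in the definition of `P`.
  have htail : Λ.map (fun ω m => ω (m + 1)) = Λ := by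
    have := congrArg (fun m => m.map Prod.snd) (map_head_tail_infinitePi ν)
    simp only [Measure.map_map measurable_snd hf, Measure.map_snd_prod, measure_univ,
      one_smul] at this
    exact this
  have hPt : ∀ᵐ ω ∂Λ, (P (fun m => ω (m + 1)) : Measure X) = stickBreaking fun m => ω (m + 1) := by
    rw [← htail] at hPa
    exact ae_of_ae_map (hf.snd).aemeasurable hPa
  have hhead : ∀ᵐ ω ∂Λ, (0 < (ω 0).1 ∧ (ω 0).1 < 1) ∧ (∀ i, 0 ≤ (ω 0).2.1 i) ∧
      ∑ i, (ω 0).2.1 i = 1 :=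
    (measurePreserving_eval_infinitePi (fun _ : ℕ => ν) 0).quasiMeasurePreserving.ae hν
  refine ⟨Λ.map P, Measure.isProbabilityMeasure_map hPm.aemeasurable, ?_⟩
  intro k B hB cell hcm hcell
  have hvec := measurable_cellMass hB
  have hvP : Measurable (cellMass B ∘ P) := hvec.comp hPm
  have hmix := measurable_mixture_map (T := fun e : ℝ × (Fin n → ℝ) × (Fin n → X) => e.1)
    measurable_fst (measurable_cellWeights hcm)
  rw [Measure.map_map hvec hPm]
  have hprod : ν.prod (Λ.map (cellMass B ∘ P)) =
      (ν.prod Λ).map (Prod.map id (cellMass B ∘ P)) := by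
    conv_lhs => rw [← Measure.map_id (μ := ν)]
    exact Measure.map_prod_map _ _ measurable_id hvP
  rw [mixtureLaw, hprod, Measure.map_map hmix (measurable_id.prodMap hvP), hΛ,
    ← map_head_tail_infinitePi, Measure.map_map (hmix.comp (measurable_id.prodMap hvP)) hf]
  refine Measure.map_congr ?_
  filter_upwards [hPa, hPt, hhead] with ω h1 h2 h3
  have : (P ω : Measure X) = mixture (ω 0).1 (ω 0).2.1 (ω 0).2.2 (P fun m => ω (m + 1)) := by
    rw [h1, mixture, h2, ← stickBreaking_eq]
  have h4 := mixture_real hB hcell h3.1.1.le h3.1.2.le h3.2.1 (ω 0).2.2 (P fun m => ω (m + 1))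
  rw [← this] at h4
  exact h4

/-- Stick-breaking with one atom per step (`n = 1`) suffices. On each partition its cell masses and
the Dirichlet distribution solve the same equation, hence have the same law. -/
theorem IsPolyaSequence.exists_isDirichletProcessLaw {X Ω : Type*} [MeasurableSpace X]
    [MeasurableSpace Ω] {α : Measure X} [IsFiniteMeasure α] (hα : α ≠ 0) {μ : Measure Ω}
    [IsProbabilityMeasure μ] {Y : ℕ → Ω → X} (hY : IsPolyaSequence α μ Y) :
    ∃ D : Measure (ProbabilityMeasure X), IsDirichletProcessLaw α D := by
  have hX : Nonempty X := by
    by_contra h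
    rw [not_nonempty_iff] at h
    exact hα (Measure.eq_zero_of_isEmpty α)
  have ha := measureReal_univ_pos hα
  let ρ : Measure (Fin 1 → X) := μ.map fun ω (i : Fin 1) => Y i ω
  have hρ : IsProbabilityMeasure ρ := Measure.isProbabilityMeasure_map
    (measurable_pi_iff.2 fun i : Fin 1 => hY.measurable i).aemeasurable
  have hν := isProbabilityMeasure_mixtureParamLaw le_rfl ha ρ
  have hae := ae_mixtureParamLaw le_rfl (α.real Set.univ) ρ
  obtain ⟨D, hD, hDm⟩ := exists_stickBreaking_solution _ hae
  refine ⟨D, hD, fun k B hB hd hu => ?_⟩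
  obtain ⟨cell, hcm, hcell⟩ := exists_cell hB hd hu
  have hvec := measurable_cellMass hB
  refine ⟨hvec.aemeasurable, ?_⟩
  change D.map (cellMass B) = _
  have hκ : IsProbabilityMeasure (D.map (cellMass B)) :=
    Measure.isProbabilityMeasure_map hvec.aemeasurable
  have hs := sum_measureReal_partition α hB hd hu
  refine eq_of_eq_mixtureLaw measurable_fst (measurable_cellWeights hcm)
    (hae.mono fun e he => he.1) ?_ ?_ (hDm k B hB cell hcm hcell)
    (hY.dirichletMeasure_eq_mixtureLaw hα le_rfl hB hd hu hcm hcell)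
  · exact (ae_map_iff hvec.aemeasurable (measurableSet_le measurable_norm measurable_const)).2
      (ae_of_all _ (norm_cellMass_le_one hB hd hu))
  · filter_upwards [ae_dirichletMeasure_nonneg (c := fun i => α.real (B i))
      (fun i => measureReal_nonneg), ae_sum_dirichletMeasure (c := fun i => α.real (B i))
      (fun i => measureReal_nonneg) (by rw [hs]; exact ha)] with v h0 h1
    exact norm_le_one_of_sum_eq_one h0 h1

/-! ### Existence of Pólya sequences. -/

/-- The predictive kernel of a Pólya sequence given its first `j + 1` terms. -/
noncomputable def polyaKernel {X : Type*} [MeasurableSpace X] (α : Measure X) (j : ℕ) :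
    Kernel ((i : Finset.Iic j) → (fun _ : ℕ => X) i) X where
  toFun x := (α Set.univ + (j + 1 : ℕ))⁻¹ • (α + ∑ i, Measure.dirac (x i))
  measurable' := by
    refine Measure.measurable_of_measurable_coe _ fun s hs => ?_
    have h1 : ∀ i, Measurable fun x : (i : Finset.Iic j) → (fun _ : ℕ => X) i =>
        Measure.dirac (x i) s := fun i =>
      (Measure.measurable_coe hs).comp (Measure.measurable_dirac.comp (measurable_pi_apply i))
    simp only [Measure.smul_apply, Measure.add_apply, Measure.finsetSum_apply, smul_eq_mul]
    fun_prop

theorem polyaKernel_apply {X : Type*} [MeasurableSpace X] (α : Measure X) (j : ℕ)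
    (x : (i : Finset.Iic j) → (fun _ : ℕ => X) i) :
    polyaKernel α j x = (α Set.univ + (j + 1 : ℕ))⁻¹ • (α + ∑ i, Measure.dirac (x i)) := rfl

instance isMarkovKernel_polyaKernel {X : Type*} [MeasurableSpace X] (α : Measure X)
    [IsFiniteMeasure α] (j : ℕ) : IsMarkovKernel (polyaKernel α j) := by
  refine ⟨fun x => ⟨?_⟩⟩
  rw [polyaKernel_apply]
  simp only [Measure.smul_apply, Measure.add_apply, Measure.finsetSum_apply, smul_eq_mul,
    measure_univ, Finset.sum_const, Finset.card_univ, Fintype.card_coe, Nat.card_Iic, nsmul_eq_mul,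
    mul_one]
  refine ENNReal.inv_mul_cancel ?_ ?_
  · simp
  · exact ENNReal.add_ne_top.2 ⟨measure_ne_top _ _, ENNReal.natCast_ne_top _⟩

theorem polyaKernel_real {X : Type*} [MeasurableSpace X] (α : Measure X) [IsFiniteMeasure α]
    (j : ℕ) (x : (i : Finset.Iic j) → (fun _ : ℕ => X) i) (A : Set X) :
    (polyaKernel α j x).real A =
      (α.real A + ∑ i, (Measure.dirac (x i)).real A) / (α.real Set.univ + (j + 1 : ℕ)) := by
  rw [polyaKernel_apply, measureReal_def]
  simp only [Measure.smul_apply, Measure.add_apply, Measure.finsetSum_apply, smul_eq_mul]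
  rw [ENNReal.toReal_mul, ENNReal.toReal_inv,
    ENNReal.toReal_add (measure_ne_top _ _) (ENNReal.natCast_ne_top _),
    ENNReal.toReal_add (measure_ne_top _ _)
      (ENNReal.sum_ne_top.2 fun i _ => measure_ne_top _ _),
    ENNReal.toReal_sum fun i _ => measure_ne_top _ _, ENNReal.toReal_natCast, div_eq_inv_mul]
  rfl

/-- The law of a Pólya sequence. -/
noncomputable def polyaMeasure {X : Type*} [MeasurableSpace X] (α : Measure X)
    [IsFiniteMeasure α] : Measure (ℕ → X) :=
  Kernel.trajMeasure (X := fun _ => X) ((α Set.univ)⁻¹ • α) (polyaKernel α)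

theorem isProbabilityMeasure_inv_smul {X : Type*} [MeasurableSpace X] {α : Measure X}
    [IsFiniteMeasure α] (hα : α ≠ 0) : IsProbabilityMeasure ((α Set.univ)⁻¹ • α) :=
  ⟨by rw [Measure.smul_apply, smul_eq_mul, ENNReal.inv_mul_cancel
    (Measure.measure_univ_ne_zero.2 hα) (measure_ne_top _ _)]⟩

theorem isProbabilityMeasure_polyaMeasure {X : Type*} [MeasurableSpace X] {α : Measure X}
    [IsFiniteMeasure α] (hα : α ≠ 0) : IsProbabilityMeasure (polyaMeasure α) := by
  have := isProbabilityMeasure_inv_smul hα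
  unfold polyaMeasure
  infer_instance

theorem map_eval_zero_polyaMeasure {X : Type*} [MeasurableSpace X] (α : Measure X)
    [IsFiniteMeasure α] :
    (polyaMeasure α).map (fun x => x 0) = (α Set.univ)⁻¹ • α := by
  have h : (polyaMeasure α).map (Preorder.frestrictLe (π := fun _ : ℕ => X) 0) =
      ((α Set.univ)⁻¹ • α).map
        (MeasurableEquiv.piUnique fun _ : Finset.Iic (0 : ℕ) => X).symm := by
    rw [polyaMeasure, Kernel.trajMeasure, Measure.map_comp _ _ (by fun_prop),
      Kernel.traj_map_frestrictLe, Kernel.partialTraj_self, Measure.id_comp]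
  let ev : ((i : Finset.Iic (0 : ℕ)) → (fun _ : ℕ => X) i) → X := fun x => x ⟨0, by simp⟩
  have hev : Measurable ev := measurable_pi_apply _
  have e1 : (fun x : ℕ → X => x 0) = ev ∘ Preorder.frestrictLe (π := fun _ : ℕ => X) 0 := rfl
  have e2 : ev ∘ (MeasurableEquiv.piUnique fun _ : Finset.Iic (0 : ℕ) => X).symm = id := rfl
  rw [e1, ← Measure.map_map hev (Preorder.measurable_frestrictLe _), h,
    Measure.map_map hev (MeasurableEquiv.measurable _), e2, Measure.map_id]

theorem comap_iic_eq_comap_fin {X Ω : Type*} [MeasurableSpace X] (Y : ℕ → Ω → X) (j : ℕ) :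
    MeasurableSpace.comap (fun ω (i : Finset.Iic j) => Y i ω) inferInstance =
      MeasurableSpace.comap (fun ω (i : Fin (j + 1)) => Y i ω) inferInstance := by
  refine le_antisymm ?_ ?_
  · refine Measurable.comap_le (@measurable_pi_iff _ _ _ (_) _ _ |>.2 fun i => ?_)
    have hi : (i : ℕ) < j + 1 := Nat.lt_succ_of_le (Finset.mem_Iic.1 i.2)
    exact (measurable_pi_apply (⟨i, hi⟩ : Fin (j + 1))).comp
      (comap_measurable fun ω (i : Fin (j + 1)) => Y i ω)
  · refine Measurable.comap_le (@measurable_pi_iff _ _ _ (_) _ _ |>.2 fun i => ?_)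
    have hi : (i : ℕ) ∈ Finset.Iic j := Finset.mem_Iic.2 (Nat.le_of_lt_succ i.2)
    exact (measurable_pi_apply (⟨i, hi⟩ : Finset.Iic j)).comp
      (comap_measurable fun ω (i : Finset.Iic j) => Y i ω)

/-- The trajectory measure disintegrates along its kernels, so `polyaKernel α j` is the conditional
distribution of the next term. The space `Ω` is arbitrary so that the sequence may also be a
coordinate of a larger product space. -/
theorem isPolyaSequence_of_map_eq {X Ω : Type*} [MeasurableSpace X] [StandardBorelSpace X]
    [MeasurableSpace Ω] {α : Measure X} [IsFiniteMeasure α] (hα : α ≠ 0) {μ : Measure Ω}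
    [IsProbabilityMeasure μ] {Z : Ω → ℕ → X} (hZ : Measurable Z)
    (hμ : μ.map Z = polyaMeasure α) : IsPolyaSequence α μ fun j ω => Z ω j := by
  have hX : Nonempty X := by
    by_contra h
    rw [not_nonempty_iff] at h
    exact hα (Measure.eq_zero_of_isEmpty α)
  have hprob := isProbabilityMeasure_inv_smul hα
  refine ⟨fun j => (measurable_pi_apply j).comp hZ,
    ⟨((measurable_pi_apply 0).comp hZ).aemeasurable, ?_⟩, ?_⟩
  · rw [← map_eval_zero_polyaMeasure α, ← hμ, Measure.map_map (measurable_pi_apply 0) hZ]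
    rfl
  intro j hj A hA
  -- The kernel of index `j` conditions on the `j + 1` terms `0, …, j` and predicts the term of
  -- index `j + 1`.
  obtain ⟨j, rfl⟩ : ∃ i, j = i + 1 := ⟨j - 1, by omega⟩
  have hres : Measurable (Preorder.frestrictLe (π := fun _ : ℕ => X) j) :=
    Preorder.measurable_frestrictLe _
  have hU : Measurable fun ω => Preorder.frestrictLe (π := fun _ : ℕ => X) j (Z ω) := hres.comp hZ
  have hV : Measurable fun ω => Z ω (j + 1) := (measurable_pi_apply (j + 1)).comp hZ
  have h := Kernel.map_frestrictLe_trajMeasure_compProd_eq_map_trajMeasure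
    (X := fun _ => X) (μ₀ := (α Set.univ)⁻¹ • α) (κ := polyaKernel α) (a := j)
  change (polyaMeasure α).map _ ⊗ₘ _ = (polyaMeasure α).map _ at h
  rw [← hμ, Measure.map_map hres hZ,
    Measure.map_map (hres.prodMk (measurable_pi_apply (j + 1))) hZ] at h
  have hc := condDistrib_ae_eq_of_measure_eq_compProd_of_measurable hU hV h.symm
  have hc' := ae_of_ae_map hU.aemeasurable hc
  have he := condDistrib_ae_eq_condExp (μ := μ) hU hV hA
  have hm := comap_iic_eq_comap_fin (fun i ω => Z ω i) j
  rw [← hm]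
  refine he.symm.trans ?_
  filter_upwards [hc'] with ω hω
  rw [hω, polyaKernel_real]
  congr 2
  refine Finset.sum_bij' (fun i _ => (⟨i, Nat.lt_succ_of_le (Finset.mem_Iic.1 i.2)⟩ : Fin (j + 1)))
    (fun i _ => (⟨i, Finset.mem_Iic.2 (Nat.le_of_lt_succ i.2)⟩ : Finset.Iic j)) ?_ ?_ ?_ ?_ ?_ <;>
    simp [Preorder.frestrictLe]

/-! ### Mutual independence and product laws. -/

/-- Disjoint blocks of independent σ-algebras are independent, so the factors split off one at a
time. The order puts `f₀`, the role of `P`, last, as in `mixtureLaw`. -/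
theorem map_prodMk_eq_of_iIndep {Ω E₀ E₁ E₂ E₃ : Type*} [MeasurableSpace Ω] [MeasurableSpace E₀]
    [MeasurableSpace E₁] [MeasurableSpace E₂] [MeasurableSpace E₃] {μ : Measure Ω}
    [IsProbabilityMeasure μ] {f₀ : Ω → E₀} {f₁ : Ω → E₁} {f₂ : Ω → E₂} {f₃ : Ω → E₃}
    (h₀ : Measurable f₀) (h₁ : Measurable f₁) (h₂ : Measurable f₂) (h₃ : Measurable f₃)
    (h : iIndep ![MeasurableSpace.comap f₀ inferInstance, MeasurableSpace.comap f₁ inferInstance,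
      MeasurableSpace.comap f₂ inferInstance, MeasurableSpace.comap f₃ inferInstance] μ) :
    μ.map (fun ω => ((f₁ ω, f₂ ω, f₃ ω), f₀ ω)) =
      ((μ.map f₁).prod ((μ.map f₂).prod (μ.map f₃))).prod (μ.map f₀) := by
  set m := ![MeasurableSpace.comap f₀ inferInstance, MeasurableSpace.comap f₁ inferInstance,
      MeasurableSpace.comap f₂ inferInstance, MeasurableSpace.comap f₃ inferInstance] with hm
  have hle : ∀ i, m i ≤ ‹MeasurableSpace Ω› := by
    intro i
    fin_cases i
    exacts [h₀.comap_le, h₁.comap_le, h₂.comap_le, h₃.comap_le]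
  have hind : ∀ {S T : Set (Fin 4)} {a b : MeasurableSpace Ω}, Disjoint S T →
      a ≤ ⨆ i ∈ S, m i → b ≤ ⨆ i ∈ T, m i → Indep a b μ := fun hST ha hb =>
    indep_of_indep_of_le_left (indep_of_indep_of_le_right (indep_iSup_of_disjoint hle h hST) hb) ha
  have hmem : ∀ {S : Set (Fin 4)} (i : Fin 4), i ∈ S → m i ≤ ⨆ i ∈ S, m i := fun i hi =>
    le_iSup₂_of_le i hi le_rfl
  have i1 : IndepFun f₂ f₃ μ := by
    rw [IndepFun_iff_Indep]
    exact hind (S := {2}) (T := {3}) (by simp) (hmem 2 (by simp)) (hmem 3 (by simp))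
  have i2 : IndepFun f₁ (fun ω => (f₂ ω, f₃ ω)) μ := by
    rw [IndepFun_iff_Indep]
    refine hind (S := {1}) (T := {2, 3}) (by simp) (hmem 1 (by simp)) ?_
    exact (MeasurableSpace.comap_prodMk f₂ f₃).le.trans
      (sup_le (hmem 2 (by simp)) (hmem 3 (by simp)))
  have i3 : IndepFun (fun ω => (f₁ ω, f₂ ω, f₃ ω)) f₀ μ := by
    rw [IndepFun_iff_Indep]
    refine hind (S := {1, 2, 3}) (T := {0}) (by simp) ?_ (hmem 0 (by simp))
    exact (MeasurableSpace.comap_prodMk f₁ fun ω => (f₂ ω, f₃ ω)).le.trans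
      (sup_le (hmem 1 (by simp)) ((MeasurableSpace.comap_prodMk f₂ f₃).le.trans
        (sup_le (hmem 2 (by simp)) (hmem 3 (by simp)))))
  rw [(indepFun_iff_map_prod_eq_prod_map_map (h₁.prodMk (h₂.prodMk h₃)).aemeasurable
    h₀.aemeasurable).1 i3, (indepFun_iff_map_prod_eq_prod_map_map h₁.aemeasurable
    (h₂.prodMk h₃).aemeasurable).1 i2, (indepFun_iff_map_prod_eq_prod_map_map h₂.aemeasurable
    h₃.aemeasurable).1 i1]

/-- Events from the four coordinates intersect in a rectangle. The function `g` is there to restrict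
the whole Pólya sequence to its first `n` terms. -/
theorem iIndep_comap_prod {E₀ E₁ E₂ E₃ F : Type*} [MeasurableSpace E₀] [MeasurableSpace E₁]
    [MeasurableSpace E₂] [MeasurableSpace E₃] [MeasurableSpace F] (μ₀ : Measure E₀)
    (μ₁ : Measure E₁) (μ₂ : Measure E₂) (μ₃ : Measure E₃) [IsProbabilityMeasure μ₀]
    [IsProbabilityMeasure μ₁] [IsProbabilityMeasure μ₂] [IsProbabilityMeasure μ₃] (g : E₃ → F) :
    iIndep ![MeasurableSpace.comap (fun ω : E₀ × E₁ × E₂ × E₃ => ω.1) inferInstance,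
      MeasurableSpace.comap (fun ω : E₀ × E₁ × E₂ × E₃ => ω.2.1) inferInstance,
      MeasurableSpace.comap (fun ω : E₀ × E₁ × E₂ × E₃ => ω.2.2.1) inferInstance,
      MeasurableSpace.comap (fun ω : E₀ × E₁ × E₂ × E₃ => g ω.2.2.2) inferInstance]
      (μ₀.prod (μ₁.prod (μ₂.prod μ₃))) := by
  classical
  rw [iIndep_iff]
  intro s f hf
  set m := ![MeasurableSpace.comap (fun ω : E₀ × E₁ × E₂ × E₃ => ω.1) inferInstance,
      MeasurableSpace.comap (fun ω : E₀ × E₁ × E₂ × E₃ => ω.2.1) inferInstance,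
      MeasurableSpace.comap (fun ω : E₀ × E₁ × E₂ × E₃ => ω.2.2.1) inferInstance,
      MeasurableSpace.comap (fun ω : E₀ × E₁ × E₂ × E₃ => g ω.2.2.2) inferInstance] with hm
  let f' : Fin 4 → Set (E₀ × E₁ × E₂ × E₃) := fun i => if i ∈ s then f i else Set.univ
  have hf' : ∀ i, MeasurableSet[m i] (f' i) := by
    intro i
    simp only [f']
    split_ifs with hi
    · exact hf i hi
    · exact MeasurableSet.univ
  have e1 : ⋂ i ∈ s, f i = ⋂ i, f' i := by
    ext x
    simp only [Set.mem_iInter, f']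
    refine ⟨fun hx i => ?_, fun hx i hi => by simpa [hi] using hx i⟩
    split_ifs with hi
    · exact hx i hi
    · trivial
  have e2 : ∏ i ∈ s, μ₀.prod (μ₁.prod (μ₂.prod μ₃)) (f i) =
      ∏ i, μ₀.prod (μ₁.prod (μ₂.prod μ₃)) (f' i) := by
    rw [← Finset.prod_subset (Finset.subset_univ s) (fun i _ hi => by simp [f', hi])]
    exact Finset.prod_congr rfl fun i hi => by simp [f', hi]
  rw [e1, e2]
  obtain ⟨A₀, hA₀, a₀⟩ := hf' 0
  obtain ⟨A₁, hA₁, a₁⟩ := hf' 1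
  obtain ⟨A₂, hA₂, a₂⟩ := hf' 2
  obtain ⟨A₃, hA₃, a₃⟩ := hf' 3
  have b₀ : f' 0 = A₀ ×ˢ (Set.univ : Set (E₁ × E₂ × E₃)) := by rw [← a₀]; ext; simp
  have b₁ : f' 1 = (Set.univ : Set E₀) ×ˢ A₁ ×ˢ (Set.univ : Set (E₂ × E₃)) := by
    rw [← a₁]; ext; simp
  have b₂ : f' 2 = (Set.univ : Set E₀) ×ˢ (Set.univ : Set E₁) ×ˢ A₂ ×ˢ (Set.univ : Set E₃) := by
    rw [← a₂]; ext; simp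
  have b₃ : f' 3 =
      (Set.univ : Set E₀) ×ˢ (Set.univ : Set E₁) ×ˢ (Set.univ : Set E₂) ×ˢ (g ⁻¹' A₃) := by
    rw [← a₃]; ext; simp
  have e3 : ⋂ i, f' i = A₀ ×ˢ A₁ ×ˢ A₂ ×ˢ (g ⁻¹' A₃) := by
    ext x
    rw [Set.mem_iInter, Fin.forall_fin_succ, Fin.forall_fin_succ, Fin.forall_fin_succ,
      Fin.forall_fin_succ]
    change x ∈ f' 0 ∧ x ∈ f' 1 ∧ x ∈ f' 2 ∧ x ∈ f' 3 ∧ _ ↔ _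
    rw [b₀, b₁, b₂, b₃]
    simp
  rw [e3, Fin.prod_univ_four, b₀, b₁, b₂, b₃]
  simp only [Measure.prod_prod, measure_univ, one_mul, mul_one, mul_assoc]

/-! ### The equation for random probability measures. -/

/-- The σ-algebra on `ProbabilityMeasure X` is pulled back from `Measure X`, where partitions
determine the law. -/
theorem ext_of_cellMass {X : Type*} [MeasurableSpace X] {D D' : Measure (ProbabilityMeasure X)}
    [IsProbabilityMeasure D]
    [IsProbabilityMeasure D']
    (h : ∀ (k : ℕ) (B : Fin k → Set X), (∀ i, MeasurableSet (B i)) →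
      Pairwise (fun i j => Disjoint (B i) (B j)) → (⋃ i, B i) = Set.univ →
      D.map (cellMass B) = D'.map (cellMass B)) : D = D' := by
  have h2 := map_eq_of_partition (μ := D) (μ' := D')
    (ξ := fun p : ProbabilityMeasure X => (p : Measure X))
    (ξ' := fun p : ProbabilityMeasure X => (p : Measure X)) measurable_subtype_coe
    measurable_subtype_coe (fun p => inferInstance) (fun p => inferInstance) h
  ext A hA
  obtain ⟨C, hC, rfl⟩ := hA
  have hcoe : Measurable fun p : ProbabilityMeasure X => (p : Measure X) := measurable_subtype_coe
  exact (Measure.map_apply hcoe hC).symm.trans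
    ((congrArg (fun m => m C) h2).trans (Measure.map_apply hcoe hC))

/-- The masses of the cells under the right-hand side of the distributional equation. -/
theorem IsEquationData.map_mixture_cells {X : Type*} [MeasurableSpace X] {Ω : Type*}
    [MeasurableSpace Ω] {α : Measure X}
    [IsFiniteMeasure α] {n : ℕ} {μ : Measure Ω} [IsProbabilityMeasure μ]
    {θ : Ω → ℝ} {q : Ω → Fin n → ℝ} {Y : ℕ → Ω → X} {P : Ω → ProbabilityMeasure X}
    (h : IsEquationData α n μ θ q Y P) {k : ℕ} {B : Fin k → Set X}
    (hB : ∀ i, MeasurableSet (B i)) {cell : X → Fin k} (hcm : Measurable cell)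
    (hcell : ∀ x i, x ∈ B i ↔ cell x = i) :
    μ.map (fun ω j => (mixture (θ ω) (q ω) (fun i => Y i ω) (P ω)).real (B j)) =
      mixtureLaw (mixtureParamLaw (α.real Set.univ) (μ.map fun ω (i : Fin n) => Y i ω))
        (fun e => e.1) (cellWeights cell) ((μ.map P).map (cellMass B)) := by
  have hZm : Measurable fun ω => fun i : Fin n => Y i ω :=
    measurable_pi_iff.2 fun i => h.polya.measurable i
  have hvec := measurable_cellMass hB
  have hmix := measurable_mixture_map (T := fun e : ℝ × (Fin n → ℝ) × (Fin n → X) => e.1)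
    measurable_fst (measurable_cellWeights hcm)
  have hjoint := map_prodMk_eq_of_iIndep h.measurable_P h.measurable_theta h.measurable_q hZm
    h.indep
  rw [h.hasLaw_theta.map_eq, h.hasLaw_q.map_eq] at hjoint
  change _ = (mixtureParamLaw (α.real Set.univ) (μ.map fun ω (i : Fin n) => Y i ω)).prod _
    at hjoint
  set J := mixtureParamLaw (α.real Set.univ) (μ.map fun ω (i : Fin n) => Y i ω) with hJ
  have hρ : IsProbabilityMeasure (μ.map fun ω (i : Fin n) => Y i ω) :=
    Measure.isProbabilityMeasure_map hZm.aemeasurable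
  have hPp : IsProbabilityMeasure (μ.map P) :=
    Measure.isProbabilityMeasure_map h.measurable_P.aemeasurable
  have hJs : SFinite J := by rw [hJ]; unfold mixtureParamLaw; infer_instance
  have hm : Measurable fun ω => ((θ ω, q ω, fun i : Fin n => Y i ω), P ω) :=
    (h.measurable_theta.prodMk (h.measurable_q.prodMk hZm)).prodMk h.measurable_P
  have hprod : J.prod ((μ.map P).map (cellMass B)) =
      (J.prod (μ.map P)).map (Prod.map id (cellMass B)) := by
    conv_lhs => rw [← Measure.map_id (μ := J)]
    exact Measure.map_prod_map _ _ measurable_id hvec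
  rw [mixtureLaw, hprod, Measure.map_map hmix (measurable_id.prodMap hvec), ← hjoint,
    Measure.map_map (hmix.comp (measurable_id.prodMap hvec)) hm]
  refine Measure.map_congr ?_
  have h1 : ∀ᵐ ω ∂μ, 0 < θ ω ∧ θ ω < 1 := by
    refine ae_of_ae_map (p := fun t => 0 < t ∧ t < 1) h.measurable_theta.aemeasurable ?_
    rw [h.hasLaw_theta.map_eq]
    exact ae_betaMeasure _ _
  have h2 : ∀ᵐ ω ∂μ, ∀ i, 0 ≤ q ω i := by
    refine ae_of_ae_map (p := fun v : Fin n → ℝ => ∀ i, 0 ≤ v i) h.measurable_q.aemeasurable ?_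
    rw [h.hasLaw_q.map_eq]
    exact ae_dirichletMeasure_nonneg fun _ => zero_le_one
  filter_upwards [h1, h2] with ω hω1 hω2
  exact mixture_real hB hcell hω1.1.le hω1.2.le hω2 (fun i => Y i ω) (P ω)

/-- A solution has cell masses solving the vector equation, which the Dirichlet distribution also
solves, so uniqueness identifies them. Conversely, for a Dirichlet process both sides have the same
cell masses in law on every partition, and these determine the law. -/
theorem solvesEquation_iff {X : Type*} [MeasurableSpace X] {Ω : Type*} [MeasurableSpace Ω]
    {α : Measure X}
    [IsFiniteMeasure α] (hα : α ≠ 0) {n : ℕ} (hn : 1 ≤ n) {μ : Measure Ω} [IsProbabilityMeasure μ]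
    {θ : Ω → ℝ} {q : Ω → Fin n → ℝ} {Y : ℕ → Ω → X} {P : Ω → ProbabilityMeasure X}
    (h : IsEquationData α n μ θ q Y P) :
    SolvesEquation μ θ q Y P ↔ IsDirichletProcessLaw α (μ.map P) := by
  have hZm : Measurable fun ω => fun i : Fin n => Y i ω :=
    measurable_pi_iff.2 fun i => h.polya.measurable i
  have hcoe : Measurable fun ω => (P ω : Measure X) := measurable_subtype_coe.comp h.measurable_P
  have hmixm : Measurable fun ω => mixture (θ ω) (q ω) (fun i : Fin n => Y i ω) (P ω) :=
    measurable_mixture h.measurable_theta h.measurable_q hZm h.measurable_P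
  have ha := measureReal_univ_pos hα
  have hρ : IsProbabilityMeasure (μ.map fun ω (i : Fin n) => Y i ω) :=
    Measure.isProbabilityMeasure_map hZm.aemeasurable
  have hPp : IsProbabilityMeasure (μ.map P) :=
    Measure.isProbabilityMeasure_map h.measurable_P.aemeasurable
  have hJp := isProbabilityMeasure_mixtureParamLaw hn ha (μ.map fun ω (i : Fin n) => Y i ω)
  have hJa := ae_mixtureParamLaw hn (α.real Set.univ) (μ.map fun ω (i : Fin n) => Y i ω)
  constructor
  · intro hsol
    refine ⟨hPp, fun k B hB hd hu => ?_⟩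
    obtain ⟨cell, hcm, hcell⟩ := exists_cell hB hd hu
    have hvec := measurable_cellMass hB
    refine ⟨hvec.aemeasurable, ?_⟩
    change (μ.map P).map (cellMass B) = _
    have hκ : IsProbabilityMeasure ((μ.map P).map (cellMass B)) :=
      Measure.isProbabilityMeasure_map hvec.aemeasurable
    have hs := sum_measureReal_partition α hB hd hu
    have hev : Measurable fun (m : Measure X) i => m.real (B i) := measurable_pi_iff.2 fun i =>
      (Measure.measurable_coe (hB i)).ennreal_toReal
    have heq := congrArg (fun m => m.map fun (m : Measure X) i => m.real (B i)) hsol.map_eq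
    simp only [Measure.map_map hev hcoe, Measure.map_map hev hmixm] at heq
    have hfix : (μ.map P).map (cellMass B) = mixtureLaw (mixtureParamLaw (α.real Set.univ)
        (μ.map fun ω (i : Fin n) => Y i ω)) (fun e => e.1) (cellWeights cell)
          ((μ.map P).map (cellMass B)) := by
      rw [← h.map_mixture_cells hB hcm hcell]
      rw [Measure.map_map hvec h.measurable_P]
      exact heq
    refine eq_of_eq_mixtureLaw measurable_fst (measurable_cellWeights hcm)
      (hJa.mono fun e he => he.1) ?_ ?_ hfix
      (h.polya.dirichletMeasure_eq_mixtureLaw hα hn hB hd hu hcm hcell)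
    · exact (ae_map_iff hvec.aemeasurable (measurableSet_le measurable_norm measurable_const)).2
        (ae_of_all _ (norm_cellMass_le_one hB hd hu))
    · filter_upwards [ae_dirichletMeasure_nonneg (c := fun i => α.real (B i))
        (fun i => measureReal_nonneg), ae_sum_dirichletMeasure (c := fun i => α.real (B i))
        (fun i => measureReal_nonneg) (by rw [hs]; exact ha)] with v h0 h1
      exact norm_le_one_of_sum_eq_one h0 h1
  · intro hD
    refine ⟨hcoe.aemeasurable, hmixm.aemeasurable, ?_⟩
    refine map_eq_of_partition hcoe hmixm (fun ω => inferInstance)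
      (fun ω => isFiniteMeasure_mixture _ _ _ _) fun k B hB hd hu => ?_
    obtain ⟨cell, hcm, hcell⟩ := exists_cell hB hd hu
    have hvec := measurable_cellMass hB
    have hlaw : (μ.map P).map (cellMass B) = dirichletMeasure fun i => α.real (B i) :=
      (hD.hasLaw_partition k B hB hd hu).map_eq
    rw [h.map_mixture_cells hB hcm hcell, hlaw,
      ← h.polya.dirichletMeasure_eq_mixtureLaw hα hn hB hd hu hcm hcell, ← hlaw,
      Measure.map_map hvec h.measurable_P]
    rfl

theorem IsDirichletProcessLaw.eq {X : Type*} [MeasurableSpace X] {α : Measure X}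
    {D D' : Measure (ProbabilityMeasure X)}
    (h : IsDirichletProcessLaw α D) (h' : IsDirichletProcessLaw α D') : D = D' := by
  have := h.isProbabilityMeasure
  have := h'.isProbabilityMeasure
  refine ext_of_cellMass fun k B hB hd hu => ?_
  exact (h.hasLaw_partition k B hB hd hu).map_eq.trans
    (h'.hasLaw_partition k B hB hd hu).map_eq.symm

theorem isPolyaSequence_polyaMeasure {X : Type*} [MeasurableSpace X] [StandardBorelSpace X]
    {α : Measure X} [IsFiniteMeasure α]
    (hα : α ≠ 0) : IsPolyaSequence α (polyaMeasure α) fun j x => x j := by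
  have := isProbabilityMeasure_polyaMeasure hα
  exact isPolyaSequence_of_map_eq hα (Z := fun x => x) measurable_id Measure.map_id

/-- The random elements of the distributional equation exist for each law of `P`. -/
theorem isEquationData_prod {X : Type*} [MeasurableSpace X] [StandardBorelSpace X] {α : Measure X}
    [IsFiniteMeasure α]
    (hα : α ≠ 0) {n : ℕ} (hn : 1 ≤ n) (D : Measure (ProbabilityMeasure X))
    [IsProbabilityMeasure D] :
    IsEquationData α n (D.prod ((betaMeasure n (α.real Set.univ)).prod
      ((dirichletMeasure fun _ : Fin n => 1).prod (polyaMeasure α))))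
      (fun ω => ω.2.1) (fun ω => ω.2.2.1) (fun j ω => ω.2.2.2 j) (fun ω => ω.1) := by
  have hβ := isProbabilityMeasureBeta (show (0 : ℝ) < n by exact_mod_cast hn)
    (measureReal_univ_pos hα)
  have hp := isProbabilityMeasure_polyaMeasure hα
  exact
    { measurable_theta := measurable_fst.comp measurable_snd
      hasLaw_theta := (measurePreserving_fst.comp measurePreserving_snd).hasLaw
      measurable_q := measurable_fst.comp (measurable_snd.comp measurable_snd)
      hasLaw_q := (measurePreserving_fst.comp
        (measurePreserving_snd.comp measurePreserving_snd)).hasLaw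
      polya := isPolyaSequence_of_map_eq hα
        (measurable_snd.comp (measurable_snd.comp measurable_snd))
        (measurePreserving_snd.comp (measurePreserving_snd.comp measurePreserving_snd)).map_eq
      measurable_P := measurable_fst
      indep := iIndep_comap_prod D _ _ (polyaMeasure α) fun x (i : Fin n) => x i }

/-- For each `n ≥ 1` the Dirichlet process with parameter `α` exists, is unique in law, and is the
unique solution of `P =_d θ ∑_{i ≤ n} q_i δ_{Y_i} + (1 - θ) P`. The last part says that the random
elements in the equation exist, with `P` a Dirichlet process. -/
theorem mainTheorem7 {X : Type u} [TopologicalSpace X] [PolishSpace X]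
    [MeasurableSpace X] [BorelSpace X] (α : Measure X) [IsFiniteMeasure α] (hα : α ≠ 0)
    (n : ℕ) (hn : 1 ≤ n) :
    (∃! D : Measure (ProbabilityMeasure X), IsDirichletProcessLaw α D) ∧
    (∀ (Ω : Type v) [MeasurableSpace Ω] (μ : Measure Ω) [IsProbabilityMeasure μ]
      (θ : Ω → ℝ) (q : Ω → Fin n → ℝ) (Y : ℕ → Ω → X) (P : Ω → ProbabilityMeasure X),
      IsEquationData α n μ θ q Y P →
        (SolvesEquation μ θ q Y P ↔ IsDirichletProcessLaw α (μ.map P))) ∧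
    (∃ (Ω : Type u) (_ : MeasurableSpace Ω) (μ : Measure Ω) (_ : IsProbabilityMeasure μ)
      (θ : Ω → ℝ) (q : Ω → Fin n → ℝ) (Y : ℕ → Ω → X) (P : Ω → ProbabilityMeasure X),
      IsEquationData α n μ θ q Y P ∧ IsDirichletProcessLaw α (μ.map P)) := by
  have hp := isProbabilityMeasure_polyaMeasure hα
  have hβ := isProbabilityMeasureBeta (show (0 : ℝ) < n by exact_mod_cast hn)
    (measureReal_univ_pos hα)
  -- This law does not depend on `n`; the same `D` serves for existence, uniqueness and the
  -- realization of the equation.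
  obtain ⟨D, hD⟩ := (isPolyaSequence_polyaMeasure hα).exists_isDirichletProcessLaw hα
  have hDp := hD.isProbabilityMeasure
  refine ⟨⟨D, hD, fun D' hD' => hD'.eq hD⟩, fun Ω _ μ _ θ q Y P h => solvesEquation_iff hα hn h,
    _, _, _, inferInstance, _, _, _, _, isEquationData_prod hα hn D, ?_⟩
  rwa [measurePreserving_fst.map_eq]
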